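/- **Setting.** Let $\mathcal T$ be a finite simplicial complex in $\mathbb R^n$ in which every simplex is contained in an $n$-simplex, let $\mathcal U\subseteq\mathcal T$ be a subcomplex, and let every simplex of $\mathcal T$ be oriented. $\mathcal T^m$, $\mathcal U^m$ denote the sets of $m$-simplices; $F\trianglelefteq C$ means that $F$ is a subsimplex of $C$ (and $F\triangleleft C$ that moreover $F\ne C$); $o(F,C)=\pm1$ is the incidence number of a facet $F$ of $C$. $\mathcal C_m(\mathcal K,\mathcal L)$ is the real vector space with basis $\mathcal K^m\setminus\mathcal L^m$, with boundary $\partial_m C=\sum_{F\triangleleft C,\,F\in\mathcal K^{m-1}\setminus\mathcal L^{m-1}}o(F,C)F$, and $\mathcal H_m(\mathcal K,\mathcal L)=\ker\partial_m/\operatorname{ran}\partial_{m+1}$. On every $C\in\mathcal T$ let finite-dimensional spaces $\Lambda^k(C)$ of smooth differential $k$-forms on $C$ (pullbacks to $C$ of smooth forms on $\mathbb R^n$) be given with $d\Lambda^k(C)\subseteq\Lambda^{k+1}(C)$ and $\operatorname{tr}_{C,F}\Lambda^k(C)=\Lambda^k(F)$ for $F\trianglelefteq C$, where $\operatorname{tr}_{C,F}$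 is the pullback from $C$ to $F$. Let $\mathring\Lambda^k(F)=\{\omega\in\Lambda^k(F):\operatorname{tr}_{F,G}\omega=0\text{ for all }G\triangleleft F\}$. Assume: * *Local exactness*: for every $C\in\mathcal T\setminus\mathcal U$, the kernel of $d$ on $\Lambda^0(C)$ is spanned by the indicator function $1_C$, and every $\omega\in\Lambda^{k+1}(C)$ with $d\omega=0$ lies in $d\Lambda^{k}(C)$ ($k\ge0$). * *Geometric decomposition*: there are linear maps $\operatorname{ext}_{F,C}^k:\mathring\Lambda^k(F)\to\Lambda^k(C)$ for $F\trianglelefteq C$ in $\mathcal T$ with $\operatorname{tr}_{C,F}\operatorname{ext}^k_{F,C}=\mathrm{Id}$, $\operatorname{tr}_{C,G}\operatorname{ext}^k_{F,C}=\operatorname{ext}^k_{F,G}$ if $F\trianglelefteq G\trianglelefteq C$, and $\operatorname{tr}_{C,G}\operatorname{ext}^k_{F,C}=0$ if $G\trianglelefteq C$ and $F\not\trianglelefteq G$. * *Local patch condition*: for all $F\in\mathcal T$ and $0\le m<n$ we have $\mathcal H_m(\mathcal M_F,\mathcal N_F)=0$, where $\mathcal M_F=\{G\in\mathcal T:\exists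 C\in\mathcal T^n,\ F\trianglelefteq C,\ G\trianglelefteq C\}$ and $\mathcal N_F=\{G\in\mathcal M_F:\dim G\le n-1,\ F\not\trianglelefteq G\text{ or }G\in\mathcal U\}$. Put $\Lambda_{-1}^k(\mathcal T^m)=\bigoplus_{C\in\mathcal T^m\setminus\mathcal U^m}\Lambda^k(C)$, each with a fixed, arbitrary scalar product; spaces with $k<0$, $m<0$ or $m>n$ are zero. Let $\mathsf D:\Lambda_{-1}^k(\mathcal T^m)\to\Lambda_{-1}^{k+1}(\mathcal T^m)$ be the simplexwise exterior derivative, and let $\mathsf T:\Lambda_{-1}^k(\mathcal T^m)\to\Lambda_{-1}^k(\mathcal T^{m-1})$ be given by $(\mathsf T\omega)_F=\sum_{C\triangleright F}o(F,C)\operatorname{tr}_{C,F}\omega_C$. For $b\ge1$ let $$\Lambda^k_{-b}(\mathcal T^m)=\bigoplus_{j=0}^{b-1}\Lambda_{-1}^{k-j}(\mathcal T^{m-j}),\qquad \Gamma^k_{-b}(\mathcal T^m)=\bigoplus_{j=0}^{b-1}\Lambda_{-1}^{k+j}(\mathcal T^{m+j})$$ be orthogonal direct sums, regarded as subspaces of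 the orthogonal direct sum of all $\Lambda^k_{-1}(\mathcal T^m)$, and let $\Lambda^k_0(\mathcal T^m)=\ker\mathsf T\cap\Lambda_{-1}^k(\mathcal T^m)$ and $\Gamma^k_0(\mathcal T^m)=\ker\mathsf D\cap\Lambda_{-1}^k(\mathcal T^m)$. The distributional exterior derivative is $\mathbf d\omega=(-1)^i(\mathsf D\omega-\mathsf T\omega)$ for $\omega\in\Lambda_{-1}^{k}(\mathcal T^{n-i})$. Define the harmonic spaces $$\mathfrak H^k(\mathcal T^n)=\{\omega\in\Lambda^k_0(\mathcal T^n):\mathsf D\omega=0,\ \omega\perp\mathsf D\Lambda_0^{k-1}(\mathcal T^n)\},\qquad \mathfrak C^0(\mathcal T^m)=\{\omega\in\Gamma^0_0(\mathcal T^m):\mathsf T\omega=0,\ \omega\perp\mathsf T\Gamma_0^{0}(\mathcal T^{m+1})\},$$ and for $b\ge1$ $$\mathfrak H^k_{-b}(\mathcal T^n)=\{\omega\in\Lambda^k_{-b}(\mathcal T^n):\mathbf d\omega=0,\ \omega\perp\mathbf d\Lambda^{k-1}_{-b+1}(\mathcal T^n)\},\qquad \mathfrak C^0_{-b}(\mathcal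 T^m)=\{\omega\in\Gamma^0_{-b}(\mathcal T^m):\mathbf d\omega=0,\ \omega\perp\mathbf d\Gamma^{0}_{-b+1}(\mathcal T^{m+1})\}.$$ Let $\mathsf E_k^m:\Lambda_{-1}^k(\mathcal T^{m-1})\to\Lambda_{-1}^k(\mathcal T^m)$ and $\mathsf P_k^m:\Lambda_{-1}^{k+1}(\mathcal T^m)\to\Lambda_{-1}^k(\mathcal T^m)$ be any linear operators with $\mathsf T\mathsf E\mathsf T=\mathsf T$ and $\mathsf D\mathsf P\mathsf D=\mathsf D$. For $2\le b\le k+1$ define $R_{k,b}$ on $\Lambda_{-b}^k(\mathcal T^n)$ by $R_{k,b}\omega=\omega-(-1)^{b+1}\mathbf d\,\mathsf E_{k-b+1}^{n-b+2}\omega$, and for $2\le b\le n-m+1$ define $S_{m,b}$ on $\Gamma^0_{-b}(\mathcal T^m)$ by $S_{m,b}\omega=\omega+(-1)^{b+n-m}\mathbf d\,\mathsf P_{b-2}^{m+b-1}\omega$, where $\mathsf E_{k-b+1}^{n-b+2}$ and $\mathsf P_{b-2}^{m+b-1}$ act on the component of $\omega$ in $\Lambda_{-1}^{k-b+1}(\mathcal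 T^{n-b+1})$ and in $\Lambda_{-1}^{b-1}(\mathcal T^{m+b-1})$, respectively. Let $R_{k,b}^*$, $S_{m,b}^*$ be the adjoints on $\Lambda_{-b}^k(\mathcal T^n)$ and $\Gamma^0_{-b}(\mathcal T^m)$, and let $Q$ be the orthogonal projection of the respective space onto the kernel of $\mathbf d$ in it. **Theorem.** For $0\le k\le n$ we have $$\mathcal H_{n-k}(\mathcal T,\mathcal U)\simeq\mathfrak C^0(\mathcal T^{n-k})=\mathfrak C^0_{-1}(\mathcal T^{n-k})\simeq\dots\simeq\mathfrak C^0_{-k-1}(\mathcal T^{n-k})=\mathfrak H^k_{-k-1}(\mathcal T^n)\simeq\dots\simeq\mathfrak H^k_{-1}(\mathcal T^n)=\mathfrak H^k(\mathcal T^n).$$ Here the first isomorphism is the one induced by identifying each simplex $C$ with $1_C$: each $\omega\in\mathfrak C^0(\mathcal T^{n-k})$ is of the form $\sum c_C1_C$ for a relative cycle $\sum c_C C$, whose homology class is mapped to $\omega$. For $2\le b\le k+1$, the operator $Q\,S_{n-k,b}^*$ restricts to an isomorphism $\mathfrak C^0_{-b+1}(\mathcal T^{n-k})\to\mathfrak C^0_{-b}(\mathcal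 T^{n-k})$, and $Q\,R_{k,b}^*$ restricts to an isomorphism $\mathfrak H^k_{-b+1}(\mathcal T^n)\to\mathfrak H^k_{-b}(\mathcal T^n)$. -/

import Mathlib

noncomputable section

namespace FEDist

/-- The ambient Euclidean space `ℝⁿ`. -/
abbrev Eucl (n : ℕ) := EuclideanSpace ℝ (Fin n)

/-! ### Smooth differential forms on a simplex

A simplex is given by the finite set `s` of its vertices; the closed simplex is `convexHull ℝ s`,
its tangent space at every point is the direction `vectorSpan ℝ s` of its affine hull. -/

/-- The tangent space of the simplex with vertex set `s`. -/
abbrev Dir {n : ℕ} (s : Finset (Eucl n)) : Submodule ℝ (Eucl n) :=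
  vectorSpan ℝ (s : Set (Eucl n))

/-- The closed simplex with vertex set `s`. -/
abbrev Simp {n : ℕ} (s : Finset (Eucl n)) : Set (Eucl n) := convexHull ℝ (s : Set (Eucl n))

/-- The fields of alternating `k`-forms on the closed simplex `s`: functions that map every point of
the simplex to an alternating `k`-form on the tangent space. -/
def FormField {n : ℕ} (k : ℕ) (s : Finset (Eucl n)) := Simp s → Dir s [⋀^Fin k]→L[ℝ] ℝ

instance {n : ℕ} (k : ℕ) (s : Finset (Eucl n)) : AddCommGroup (FormField k s) :=
  inferInstanceAs (AddCommGroup (Simp s → Dir s [⋀^Fin k]→L[ℝ] ℝ))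

instance {n : ℕ} (k : ℕ) (s : Finset (Eucl n)) : Module ℝ (FormField k s) :=
  inferInstanceAs (Module ℝ (Simp s → Dir s [⋀^Fin k]→L[ℝ] ℝ))

/-- Pullback to the simplex `s` of a differential `k`-form on `ℝⁿ`. -/
def pull {n : ℕ} (k : ℕ) (s : Finset (Eucl n)) (η : Eucl n → Eucl n [⋀^Fin k]→L[ℝ] ℝ) :
    FormField k s :=
  fun x => (η x).compContinuousLinearMap (Dir s).subtypeL

theorem pull_add {n : ℕ} (k : ℕ) (s : Finset (Eucl n))
    (η ζ : Eucl n → Eucl n [⋀^Fin k]→L[ℝ] ℝ) :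
    pull k s (η + ζ) = pull k s η + pull k s ζ := rfl

theorem pull_smul {n : ℕ} (k : ℕ) (s : Finset (Eucl n)) (c : ℝ)
    (η : Eucl n → Eucl n [⋀^Fin k]→L[ℝ] ℝ) :
    pull k s (c • η) = c • pull k s η := rfl

/-- The smooth differential `k`-forms on the closed simplex `s`: the pullbacks of the smooth
differential `k`-forms on `ℝⁿ`. -/
def SmoothForm {n : ℕ} (k : ℕ) (s : Finset (Eucl n)) : Submodule ℝ (FormField k s) where
  carrier := {ω | ∃ η : Eucl n → Eucl n [⋀^Fin k]→L[ℝ] ℝ,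
    ContDiff ℝ (⊤ : ℕ∞) η ∧ ω = pull k s η}
  zero_mem' := ⟨0, contDiff_const, rfl⟩
  add_mem' := by
    rintro _ _ ⟨η, hη, rfl⟩ ⟨ζ, hζ, rfl⟩
    exact ⟨η + ζ, hη.add hζ, rfl⟩
  smul_mem' := by
    rintro c _ ⟨η, hη, rfl⟩
    exact ⟨c • η, contDiff_const.smul hη, rfl⟩

/-- The pullback of `dη` to the simplex vanishes if the pullback of `η` does. -/
theorem pull_extDeriv_eq_zero {n : ℕ} (k : ℕ) (s : Finset (Eucl n))
    (η : Eucl n → Eucl n [⋀^Fin k]→L[ℝ] ℝ) (hη : ContDiff ℝ (⊤ : ℕ∞) η) (h : pull k s η = 0) :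
    pull (k + 1) s (extDeriv η) = 0 := by
  have hd : Differentiable ℝ η := hη.differentiable (by simp)
  have key : ∀ x ∈ Simp s, ∀ v ∈ Dir s, ∀ w : Fin k → Dir s,
      fderiv ℝ (fun y => η y (fun i => (w i : Eucl n))) x v = 0 := by
    intro x hx v hv w
    have hv' : v ∈ Submodule.span ℝ ((fun y => y - x) '' Simp s) := by
      have h1 : Dir s ≤ vectorSpan ℝ (Simp s) := vectorSpan_mono ℝ (subset_convexHull ℝ _)
      have h2 := h1 hv
      rwa [vectorSpan_eq_span_vsub_set_right ℝ hx] at h2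
    have hdw : Differentiable ℝ (fun y => η y (fun i => (w i : Eucl n))) := fun y =>
      ((ContinuousAlternatingMap.apply ℝ (Eucl n) ℝ
        (fun i => (w i : Eucl n))).differentiableAt).comp y (hd y)
    refine Submodule.span_induction (p := fun v _ =>
      fderiv ℝ (fun y => η y (fun i => (w i : Eucl n))) x v = 0) ?_ (by simp) ?_ ?_ hv'
    · rintro _ ⟨y, hy, rfl⟩
      have hline : HasDerivAt (fun t : ℝ => x + t • (y - x)) (y - x) 0 := by
        simpa using ((hasDerivAt_id (0 : ℝ)).smul_const (y - x)).const_add x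
      have hg : HasDerivAt (fun t : ℝ => η (x + t • (y - x)) (fun i => (w i : Eucl n)))
          (fderiv ℝ (fun y => η y (fun i => (w i : Eucl n))) (x + (0 : ℝ) • (y - x)) (y - x)) 0 :=
        HasFDerivAt.comp_hasDerivAt (f := fun t : ℝ => x + t • (y - x)) (0 : ℝ)
          (hdw (x + (0 : ℝ) • (y - x))).hasFDerivAt hline
      rw [zero_smul, add_zero] at hg
      have hz : HasDerivWithinAt (fun t : ℝ => η (x + t • (y - x)) (fun i => (w i : Eucl n)))
          0 (Set.Icc 0 1) 0 := by
        refine (hasDerivWithinAt_const (0 : ℝ) (Set.Icc (0 : ℝ) 1) (0 : ℝ)).congr_of_mem ?_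
          (by simp)
        intro t ht
        have hm : x + t • (y - x) ∈ Simp s :=
          (convex_convexHull ℝ _).add_smul_sub_mem hx hy ht
        exact congrArg (fun α => α w) (congrFun h ⟨_, hm⟩)
      exact (uniqueDiffOn_Icc (by norm_num : (0 : ℝ) < 1) 0 (by simp)).eq_deriv _
        hg.hasDerivWithinAt hz
    · intro a b _ _ ha hb
      rw [map_add, ha, hb, add_zero]
    · intro c a _ ha
      rw [map_smul, ha, smul_zero]
  funext x
  ext v
  have h0 := extDeriv_apply (hd x) (fun i => (v i : Eucl n))
  change extDeriv η x (fun i => (v i : Eucl n)) = 0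
  rw [h0]
  refine Finset.sum_eq_zero fun i _ => ?_
  have h1 : fderiv ℝ (fun y => η y (i.removeNth fun j => (v j : Eucl n))) x (v i) = 0 :=
    key x x.2 (v i) (v i).2 (i.removeNth v)
  rw [h1, smul_zero]

theorem contDiff_extDeriv {n : ℕ} {k : ℕ} {η : Eucl n → Eucl n [⋀^Fin k]→L[ℝ] ℝ}
    (hη : ContDiff ℝ (⊤ : ℕ∞) η) : ContDiff ℝ (⊤ : ℕ∞) (extDeriv η) :=
  (ContinuousAlternatingMap.alternatizeUncurryFinCLM ℝ (Eucl n) ℝ (n := k)).contDiff.comp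
    (hη.fderiv_right (by simp))

theorem pull_extDeriv_add {n : ℕ} (k : ℕ) (s : Finset (Eucl n))
    {η ζ : Eucl n → Eucl n [⋀^Fin k]→L[ℝ] ℝ} (hη : ContDiff ℝ (⊤ : ℕ∞) η)
    (hζ : ContDiff ℝ (⊤ : ℕ∞) ζ) :
    pull (k + 1) s (extDeriv (η + ζ)) =
      pull (k + 1) s (extDeriv η) + pull (k + 1) s (extDeriv ζ) := by
  rw [← pull_add]
  congr 1
  funext x
  exact extDeriv_add (hη.differentiable (by simp) x) (hζ.differentiable (by simp) x)

theorem pull_extDeriv_smul {n : ℕ} (k : ℕ) (s : Finset (Eucl n)) (c : ℝ)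
    (η : Eucl n → Eucl n [⋀^Fin k]→L[ℝ] ℝ) :
    pull (k + 1) s (extDeriv (c • η)) = c • pull (k + 1) s (extDeriv η) := by
  rw [← pull_smul]
  congr 1
  funext x
  exact extDeriv_smul c η

theorem pull_extDeriv_congr {n : ℕ} (k : ℕ) (s : Finset (Eucl n))
    {η ζ : Eucl n → Eucl n [⋀^Fin k]→L[ℝ] ℝ} (hη : ContDiff ℝ (⊤ : ℕ∞) η)
    (hζ : ContDiff ℝ (⊤ : ℕ∞) ζ) (h : pull k s η = pull k s ζ) :
    pull (k + 1) s (extDeriv η) = pull (k + 1) s (extDeriv ζ) := by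
  have h0 : pull k s (η + (-1 : ℝ) • ζ) = 0 := by
    rw [pull_add, pull_smul, h, neg_one_smul, add_neg_cancel]
  have hζ' : ContDiff ℝ (⊤ : ℕ∞) ((-1 : ℝ) • ζ) := contDiff_const.smul hζ
  have h1 : pull (k + 1) s (extDeriv (η + (-1 : ℝ) • ζ)) = 0 :=
    pull_extDeriv_eq_zero k s _ (hη.add hζ') h0
  rwa [pull_extDeriv_add k s hη hζ', pull_extDeriv_smul, neg_one_smul,
    add_neg_eq_zero] at h1

/-- The exterior derivative of a smooth form on the simplex `s`: the pullback of `dη`, where `η`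
is any smooth form on `ℝⁿ` that extends it (see `dForm_eq`). -/
def dForm {n : ℕ} (k : ℕ) (s : Finset (Eucl n)) : SmoothForm k s →ₗ[ℝ] SmoothForm (k + 1) s where
  toFun ω := ⟨pull (k + 1) s (extDeriv ω.2.choose),
    ⟨_, contDiff_extDeriv ω.2.choose_spec.1, rfl⟩⟩
  map_add' ω ω' := by
    apply Subtype.ext
    obtain ⟨e1, f1⟩ := ω.2.choose_spec
    obtain ⟨e2, f2⟩ := ω'.2.choose_spec
    obtain ⟨e3, f3⟩ := (ω + ω').2.choose_spec
    have h : pull k s (ω + ω').2.choose = pull k s (ω.2.choose + ω'.2.choose) := by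
      rw [← f3, pull_add, ← f1, ← f2]
      rfl
    exact (pull_extDeriv_congr k s e3 (e1.add e2) h).trans (pull_extDeriv_add k s e1 e2)
  map_smul' c ω := by
    apply Subtype.ext
    obtain ⟨e1, f1⟩ := ω.2.choose_spec
    obtain ⟨e3, f3⟩ := (c • ω).2.choose_spec
    have h : pull k s (c • ω).2.choose = pull k s (c • ω.2.choose) := by
      rw [← f3, pull_smul, ← f1]
      rfl
    exact (pull_extDeriv_congr k s e3 (contDiff_const.smul e1) h).trans
      (pull_extDeriv_smul k s c _)

theorem dForm_eq {n : ℕ} {k : ℕ} {s : Finset (Eucl n)} (ω : SmoothForm k s)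
    {η : Eucl n → Eucl n [⋀^Fin k]→L[ℝ] ℝ} (hη : ContDiff ℝ (⊤ : ℕ∞) η)
    (h : (ω : FormField k s) = pull k s η) :
    (dForm k s ω : FormField (k + 1) s) = pull (k + 1) s (extDeriv η) :=
  pull_extDeriv_congr k s ω.2.choose_spec.1 hη (ω.2.choose_spec.2.symm.trans h)

/-- The pullback of a field of alternating forms along the inclusion of a subsimplex `F` of `C`. -/
def FormField.restrict {n : ℕ} {k : ℕ} {F C : Finset (Eucl n)} (h : F ⊆ C) (ω : FormField k C) :
    FormField k F :=
  fun x => (ω ⟨x, convexHull_mono (Finset.coe_subset.2 h) x.2⟩).compContinuousLinearMap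
    ((Dir F).subtypeL.codRestrict (Dir C)
      fun v => vectorSpan_mono ℝ (Finset.coe_subset.2 h) v.2)

theorem FormField.restrict_pull {n : ℕ} {k : ℕ} {F C : Finset (Eucl n)} (h : F ⊆ C)
    (η : Eucl n → Eucl n [⋀^Fin k]→L[ℝ] ℝ) : (pull k C η).restrict h = pull k F η := rfl

/-- The (tangential) trace of a smooth form from the simplex `C` to a subsimplex `F`: the pullback
along the inclusion. -/
def trace {n : ℕ} (k : ℕ) {F C : Finset (Eucl n)} (h : F ⊆ C) :
    SmoothForm k C →ₗ[ℝ] SmoothForm k F where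
  toFun ω := ⟨(ω : FormField k C).restrict h, by
    obtain ⟨ω, η, hη, rfl⟩ := ω
    exact ⟨η, hη, rfl⟩⟩
  map_add' _ _ := rfl
  map_smul' _ _ := rfl

/-- The indicator function `1_C` of the simplex `C`, as a smooth `0`-form on `C`. -/
def indicator {n : ℕ} (C : Finset (Eucl n)) : SmoothForm 0 C :=
  ⟨fun _ => ContinuousAlternatingMap.constOfIsEmpty ℝ (Dir C) (Fin 0) 1,
    ⟨fun _ => ContinuousAlternatingMap.constOfIsEmpty ℝ (Eucl n) (Fin 0) 1, contDiff_const, rfl⟩⟩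

/-! ### Triangulations with finite element spaces -/

/-- The `m`-dimensional simplices `𝒯^m` of a simplicial complex. -/
abbrev Face {n : ℕ} (T : Geometry.SimplicialComplex ℝ (Eucl n)) (m : ℕ) :=
  {s : Finset (Eucl n) // s ∈ T.faces ∧ s.card = m + 1}

/-- A finite `n`-dimensional simplicial complex `𝒯` in `ℝⁿ` with a subcomplex `𝒰`, an orientation
of every simplex, and on every simplex a finite-dimensional complex of smooth differential forms
such that the traces are surjective. (Only the spaces on the simplices of `𝒯` matter.) -/
structure FEComplex (n : ℕ) where
  T : Geometry.SimplicialComplex ℝ (Eucl n)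
  U : Geometry.SimplicialComplex ℝ (Eucl n)
  finite_faces : T.faces.Finite
  exists_supersimplex : ∀ s ∈ T.faces, ∃ C ∈ T.faces, s ⊆ C ∧ C.card = n + 1
  subcomplex : U.faces ⊆ T.faces
  orient : ∀ (m : ℕ) (C : Face T m), Orientation ℝ (Dir C.1) (Fin m)
  space : ∀ (k : ℕ) (s : Finset (Eucl n)), Submodule ℝ (SmoothForm k s)
  finiteDimensional : ∀ k, ∀ s ∈ T.faces, FiniteDimensional ℝ (space k s)
  dForm_mem : ∀ k, ∀ s ∈ T.faces, ∀ ω ∈ space k s, dForm k s ω ∈ space (k + 1) s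
  map_trace : ∀ k, ∀ C ∈ T.faces, ∀ F ∈ T.faces, ∀ h : F ⊆ C,
    (space k C).map (trace k h) = space k F

namespace FEComplex

variable {n : ℕ} (A : FEComplex n)

/-- The vector `p - v` for `p ∈ F ⊆ C` and `v ∈ C`, as a tangent vector of `C`. -/
def vec {F C : Finset (Eucl n)} (h : F ⊆ C) {p v : Eucl n} (hp : p ∈ F) (hv : v ∈ C) : Dir C :=
  ⟨p -ᵥ v, vsub_mem_vectorSpan ℝ (Finset.mem_coe.2 (h hp)) (Finset.mem_coe.2 hv)⟩

/-- The orientation that `C` induces on its face `F` ("outward vector first") coincides with the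
chosen orientation of `F`. If the form `α` represents the orientation of `C`, then the induced
orientation is represented by the restriction to `F` of the contraction of `α` with the vector
`p - v`, which points out of `C` through `F`; here `p` is a vertex of `F` and `v` the
vertex of `C` opposite to `F`. -/
def InducesOrient {m : ℕ} (F : Face A.T m) (C : Face A.T (m + 1)) (h : F.1 ⊆ C.1) : Prop :=
  ∃ (p : Eucl n) (hp : p ∈ F.1) (v : Eucl n) (hv : v ∈ C.1), v ∉ F.1 ∧
    SameRay ℝ
      (((A.orient (m + 1) C).someVector.curryLeft (vec h hp hv)).compLinearMap
        (Submodule.inclusion (vectorSpan_mono ℝ (Finset.coe_subset.2 h))))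
      (A.orient m F).someVector

open Classical in
/-- The incidence number `o(F, C) = ±1` if `F` is a subsimplex of `C`, and `0` otherwise. -/
def incidence {m : ℕ} (F : Face A.T m) (C : Face A.T (m + 1)) : ℝ :=
  if h : F.1 ⊆ C.1 then (if A.InducesOrient F C h then 1 else -1) else 0

/-! ### Relative simplicial homology -/

/-- The `m`-simplices of `𝒯` that are in `K` but not in `L`. -/
abbrev RelFace (K L : Set (Finset (Eucl n))) (m : ℕ) := {C : Face A.T m // C.1 ∈ K ∧ C.1 ∉ L}

instance (K L : Set (Finset (Eucl n))) (m : ℕ) : Finite (A.RelFace K L m) := by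
  have : Finite A.T.faces := A.finite_faces
  exact Finite.of_injective (fun C : A.RelFace K L m => (⟨C.1.1, C.1.2.1⟩ : A.T.faces))
    fun C C' h => Subtype.ext (Subtype.ext (by simpa using h))

instance (K L : Set (Finset (Eucl n))) (m : ℕ) : Fintype (A.RelFace K L m) := Fintype.ofFinite _

/-- The relative simplicial chains `𝒞_m(K, L)` of subcomplexes `L ⊆ K` of `𝒯`: the vector space
with basis `K^m \ L^m`. -/
abbrev Chain (K L : Set (Finset (Eucl n))) (m : ℕ) := A.RelFace K L m → ℝ

/-- The relative simplicial boundary operator `∂_{m+1} : 𝒞_{m+1}(K, L) → 𝒞_m(K, L)`. -/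
def bdry (K L : Set (Finset (Eucl n))) (m : ℕ) : A.Chain K L (m + 1) →ₗ[ℝ] A.Chain K L m where
  toFun c F := ∑ C, A.incidence F.1 C.1 * c C
  map_add' c c' := by
    funext F
    simp [mul_add, Finset.sum_add_distrib]
  map_smul' r c := by
    funext F
    simp [Finset.mul_sum, mul_left_comm]

/-- The relative cycles, the kernel of `∂_m` (where `∂_0 = 0`). -/
def cycles (K L : Set (Finset (Eucl n))) : (m : ℕ) → Submodule ℝ (A.Chain K L m)
  | 0 => ⊤
  | m + 1 => LinearMap.ker (A.bdry K L m)

/-- The relative simplicial homology space `ℋ_m(K, L) = ker ∂_m / ran ∂_{m+1}`. -/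
abbrev Homology (K L : Set (Finset (Eucl n))) (m : ℕ) :=
  A.cycles K L m ⧸ (LinearMap.range (A.bdry K L m)).submoduleOf (A.cycles K L m)

/-! ### The three conditions -/

/-- The local exactness condition. -/
def LocalExactness : Prop :=
  ∀ C ∈ A.T.faces, C ∉ A.U.faces →
    (A.space 0 C ⊓ LinearMap.ker (dForm 0 C) = Submodule.span ℝ {indicator C}) ∧
    ∀ k, ∀ ω ∈ A.space (k + 1) C, dForm (k + 1) C ω = 0 → ∃ η ∈ A.space k C, dForm k C η = ω

/-- The forms in `Λ^k(F)` with vanishing traces on all proper subsimplices of `F`. -/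
def bubble (k : ℕ) (F : Finset (Eucl n)) : Submodule ℝ (SmoothForm k F) :=
  A.space k F ⊓ ⨅ (G : Finset (Eucl n)) (_ : G ∈ A.T.faces) (h : G ⊂ F),
    LinearMap.ker (trace k h.subset)

/-- The geometric decomposition condition. -/
def GeometricDecomposition : Prop :=
  ∃ ext : ∀ (k : ℕ) (F C : Finset (Eucl n)), A.bubble k F →ₗ[ℝ] SmoothForm k C,
    ∀ k, ∀ F ∈ A.T.faces, ∀ C ∈ A.T.faces, ∀ hFC : F ⊆ C, ∀ ω : A.bubble k F,
      ext k F C ω ∈ A.space k C ∧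
      trace k hFC (ext k F C ω) = ω ∧
      ∀ G ∈ A.T.faces, ∀ hGC : G ⊆ C,
        (F ⊆ G → trace k hGC (ext k F C ω) = ext k F G ω) ∧
        (¬ F ⊆ G → trace k hGC (ext k F C ω) = 0)

/-- The element patch `ℳ_F` around `F`. -/
def patch (F : Finset (Eucl n)) : Set (Finset (Eucl n)) :=
  {G | G ∈ A.T.faces ∧ ∃ C ∈ A.T.faces, C.card = n + 1 ∧ F ⊆ C ∧ G ⊆ C}

/-- The complex `𝒩_F`: the simplices of `ℳ_F` of dimension at most `n - 1` that do not contain `F`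
or belong to `𝒰`. -/
def patchBdry (F : Finset (Eucl n)) : Set (Finset (Eucl n)) :=
  {G | G ∈ A.patch F ∧ G.card ≤ n ∧ (¬ F ⊆ G ∨ G ∈ A.U.faces)}

/-- The local patch condition of `𝒯` relative to `𝒰`. -/
def LocalPatch : Prop :=
  ∀ F ∈ A.T.faces, ∀ m < n, Subsingleton (A.Homology (A.patch F) (A.patchBdry F) m)

/-! ### Discrete distributional differential forms -/

/-- The trace `Λ^k(C) → Λ^k(F)`. -/
def tr (k : ℕ) {F C : Finset (Eucl n)} (hC : C ∈ A.T.faces) (hF : F ∈ A.T.faces) (h : F ⊆ C) :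
    A.space k C →ₗ[ℝ] A.space k F :=
  (trace k h).restrict fun ω hω => by
    rw [← A.map_trace k C hC F hF h]; exact Submodule.mem_map_of_mem hω

/-- The exterior derivative `Λ^k(C) → Λ^{k+1}(C)`. -/
def dd (k : ℕ) {C : Finset (Eucl n)} (hC : C ∈ A.T.faces) :
    A.space k C →ₗ[ℝ] A.space (k + 1) C :=
  (dForm k C).restrict (A.dForm_mem k C hC)

/-- The simplices `𝒯^m \ 𝒰^m`. -/
abbrev Cell (m : ℕ) := A.RelFace A.T.faces A.U.faces m

/-- The space `Λ_{-1}^k(𝒯^m) = ⨁ Λ^k(C)`, where `C` ranges over `𝒯^m \ 𝒰^m`. -/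
abbrev Broken (k m : ℕ) := (C : A.Cell m) → A.space k C.1.1

/-- The horizontal differential `D_k^m : Λ_{-1}^k(𝒯^m) → Λ_{-1}^{k+1}(𝒯^m)`. -/
def D (k m : ℕ) : A.Broken k m →ₗ[ℝ] A.Broken (k + 1) m where
  toFun ω C := A.dd k C.1.2.1 (ω C)
  map_add' _ _ := by funext C; simp
  map_smul' _ _ := by funext C; simp

open Classical in
/-- The vertical differential `T_k^{m+1} : Λ_{-1}^k(𝒯^{m+1}) → Λ_{-1}^k(𝒯^m)`. -/
def Tv (k m : ℕ) : A.Broken k (m + 1) →ₗ[ℝ] A.Broken k m where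
  toFun ω F := ∑ C : A.Cell (m + 1), if h : F.1.1 ⊆ C.1.1 then
    A.incidence F.1 C.1 • A.tr k C.1.2.1 F.1.2.1 h (ω C) else 0
  map_add' ω ω' := by
    funext F
    simp only [Pi.add_apply, ← Finset.sum_add_distrib]
    exact Finset.sum_congr rfl fun C _ => by split_ifs <;> simp
  map_smul' c ω := by
    funext F
    simp only [Pi.smul_apply, RingHom.id_apply, Finset.smul_sum]
    exact Finset.sum_congr rfl fun C _ => by split_ifs <;> simp [smul_comm c]

/-- A choice of a scalar product on each of the spaces `Λ_{-1}^k(𝒯^m)`. -/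
abbrev ScalarProducts := ∀ k m : ℕ, InnerProductSpace.Core ℝ (A.Broken k m)

variable (S : A.ScalarProducts)

/-- The space `Λ_{-1}^k(𝒯^m)`, equipped with the chosen scalar product. -/
def HBroken (_ : A.ScalarProducts) (k m : ℕ) := A.Broken k m

instance (k m : ℕ) : NormedAddCommGroup (A.HBroken S k m) :=
  @InnerProductSpace.Core.toNormedAddCommGroup ℝ (A.Broken k m) _ _ _ (S k m)

instance (k m : ℕ) : InnerProductSpace ℝ (A.HBroken S k m) :=
  InnerProductSpace.ofCore (S k m).toCore

instance (k m : ℕ) : FiniteDimensional ℝ (A.HBroken S k m) := by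
  have : ∀ C : A.Cell m, FiniteDimensional ℝ (A.space k C.1.1) :=
    fun C => A.finiteDimensional k C.1.1 C.1.2.1
  exact inferInstanceAs (FiniteDimensional ℝ (A.Broken k m))

/-- The identity map from `Λ_{-1}^k(𝒯^m)` to the same space with the chosen scalar product. -/
def toH (k m : ℕ) : A.Broken k m ≃ₗ[ℝ] A.HBroken S k m where
  toFun ω := ω
  invFun ω := ω
  map_add' _ _ := rfl
  map_smul' _ _ := rfl

/-- A linear map between spaces `Λ_{-1}^k(𝒯^m)`, considered as a map between the same spaces with the
chosen scalar products. -/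
def lift {k m k' m' : ℕ} (f : A.Broken k m →ₗ[ℝ] A.Broken k' m') :
    A.HBroken S k m →ₗ[ℝ] A.HBroken S k' m' :=
  (A.toH S k' m').toLinearMap ∘ₗ f ∘ₗ (A.toH S k m).symm.toLinearMap

/-- The Hilbert space `⨁ Λ_{-1}^k(𝒯^m)` over all form degrees `0 ≤ k ≤ n` and all simplex
dimensions `0 ≤ m ≤ n`; the component of `ω` in `Λ_{-1}^k(𝒯^m)` is `ω (k, m)`. It is the orthogonal
direct sum of these spaces, and all spaces of discrete distributional differential forms are
subspaces of it. -/
abbrev Total := PiLp 2 fun p : Fin (n + 1) × Fin (n + 1) => A.HBroken S p.1 p.2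

/-- The horizontal differentials `D_k^m`, for all `k` and `m` at once. -/
def DD : A.Total S →ₗ[ℝ] A.Total S where
  toFun ω := WithLp.toLp 2 fun p => match p with
    | (⟨0, _⟩, _) => 0
    | (⟨k + 1, hk⟩, m) => A.lift S (A.D k m) (ω (⟨k, by omega⟩, m))
  map_add' ω ω' := by
    ext ⟨⟨_ | k, hk⟩, m⟩ : 1
    · exact (add_zero _).symm
    · exact (A.lift S (A.D k m)).map_add _ _
  map_smul' c ω := by
    ext ⟨⟨_ | k, hk⟩, m⟩ : 1
    · exact (smul_zero (A := A.HBroken S 0 m) c).symm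
    · exact (A.lift S (A.D k m)).map_smul _ _

/-- The vertical differentials `T_k^m`, for all `k` and `m` at once. -/
def TT : A.Total S →ₗ[ℝ] A.Total S where
  toFun ω := WithLp.toLp 2 fun p =>
    if h : (p.2 : ℕ) < n then A.lift S (A.Tv p.1 p.2) (ω (p.1, ⟨p.2 + 1, Nat.succ_lt_succ h⟩)) else 0
  map_add' ω ω' := by
    ext p : 1
    by_cases h : (p.2 : ℕ) < n <;> simp [h]
  map_smul' c ω := by
    ext p : 1
    by_cases h : (p.2 : ℕ) < n <;> simp [h]

/-- Multiplication of the components in `Λ_{-1}^k(𝒯^{n-i})` by `(-1)^i`. -/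
def sgn : A.Total S →ₗ[ℝ] A.Total S where
  toFun ω := WithLp.toLp 2 fun p => (-1 : ℝ) ^ (n - (p.2 : ℕ)) • ω p
  map_add' ω ω' := by ext p : 1; simp
  map_smul' c ω := by ext p : 1; simp [smul_comm c]

/-- The discrete distributional exterior derivative
`d ω = (-1)^i D ω - (-1)^i T ω` for `ω ∈ Λ_{-1}^k(𝒯^{n-i})`. -/
def d : A.Total S →ₗ[ℝ] A.Total S := (A.DD S - A.TT S) ∘ₗ A.sgn S

/-- The forms all of whose components with an index outside of `I` vanish. -/
def supported (I : Set (ℕ × ℕ)) : Submodule ℝ (A.Total S) where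
  carrier := {ω | ∀ p : Fin (n + 1) × Fin (n + 1), ((p.1 : ℕ), (p.2 : ℕ)) ∉ I → ω p = 0}
  zero_mem' _ _ := rfl
  add_mem' h h' p hp := by simp [h p hp, h' p hp]
  smul_mem' c ω h p hp := by simp [h p hp]

/-- The space `Λ_{-b}^k(𝒯^m)`, i.e. `⨁_{0 ≤ j < b} Λ_{-1}^{k-j}(𝒯^{m-j})` for `b ≥ 1`, and
`Λ_0^k(𝒯^m) = Λ^k(𝒯^m) = {ω ∈ Λ_{-1}^k(𝒯^m) | T ω = 0}` for `b = 0`. The space is zero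
for `k < 0`. -/
def Lam (k : ℤ) (m : ℕ) : ℕ → Submodule ℝ (A.Total S)
  | 0 => A.supported S {q | (q.1 : ℤ) = k ∧ q.2 = m} ⊓ LinearMap.ker (A.TT S)
  | b + 1 => A.supported S {q | ∃ j < b + 1, (q.1 : ℤ) + j = k ∧ q.2 + j = m}

/-- The space `Γ_{-b}^k(𝒯^m)`, i.e. `⨁_{0 ≤ j < b} Λ_{-1}^{k+j}(𝒯^{m+j})` for `b ≥ 1`, and
`Γ_0^k(𝒯^m) = Γ^k(𝒯^m) = {ω ∈ Λ_{-1}^k(𝒯^m) | D ω = 0}` for `b = 0`. -/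
def Gam (k m : ℕ) : ℕ → Submodule ℝ (A.Total S)
  | 0 => A.supported S {q | q.1 = k ∧ q.2 = m} ⊓ LinearMap.ker (A.DD S)
  | b + 1 => A.supported S {q | ∃ j < b + 1, q.1 = k + j ∧ q.2 = m + j}

/-! ### Harmonic spaces -/

/-- The harmonic space `ℌ^k(𝒯^m)` of the complex `… → Λ^k(𝒯^m) → Λ^{k+1}(𝒯^m) → …` with the
differentials `D`; for `m = n` these are the discrete harmonic forms. -/
def harm (k : ℤ) (m : ℕ) : Submodule ℝ (A.Total S) :=
  A.Lam S k m 0 ⊓ LinearMap.ker (A.DD S) ⊓ ((A.Lam S (k - 1) m 0).map (A.DD S))ᗮ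

/-- The harmonic space `ℭ^k(𝒯^m)` of the complex `… → Γ^k(𝒯^m) → Γ^k(𝒯^{m-1}) → …` with the
differentials `T`. -/
def vharm (k m : ℕ) : Submodule ℝ (A.Total S) :=
  A.Gam S k m 0 ⊓ LinearMap.ker (A.TT S) ⊓ ((A.Gam S k (m + 1) 0).map (A.TT S))ᗮ

/-- The distributional harmonic space `ℌ_{-b}^k(𝒯^m)`, for `b ≥ 1`. -/
def distHarm (k : ℤ) (m b : ℕ) : Submodule ℝ (A.Total S) :=
  A.Lam S k m b ⊓ LinearMap.ker (A.d S) ⊓ ((A.Lam S (k - 1) m (b - 1)).map (A.d S))ᗮ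

/-- The distributional harmonic space `ℭ_{-b}^k(𝒯^m)`, for `b ≥ 1`. -/
def distVharm (k m b : ℕ) : Submodule ℝ (A.Total S) :=
  A.Gam S k m b ⊓ LinearMap.ker (A.d S) ⊓ ((A.Gam S k (m + 1) (b - 1)).map (A.d S))ᗮ

/-- The indicator function of `C ∈ 𝒯^m \ 𝒰^m` as an element of `Λ^0(C)`. -/
def indicatorForm (hA : A.LocalExactness) {m : ℕ} (C : A.Cell m) : A.space 0 C.1.1 :=
  ⟨indicator C.1.1, ((hA C.1.1 C.2.1 C.2.2).1.ge (Submodule.mem_span_singleton_self _)).1⟩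

/-- The element `∑ c_C 1_C` of `Λ_{-1}^0(𝒯^m)` that corresponds to the chain `∑ c_C C`. -/
def chainForm (hA : A.LocalExactness) {m : ℕ} (hm : m ≤ n)
    (c : A.Chain A.T.faces A.U.faces m) : A.Total S :=
  WithLp.toLp 2 (Pi.single (⟨0, n.succ_pos⟩, ⟨m, Nat.lt_succ_of_le hm⟩)
    (A.toH S 0 m fun C => c C • A.indicatorForm hA C))

/-! ### The regularizers -/

/-- The projection of `ω` onto its component in `Λ_{-1}^k(𝒯^m)`. -/
def component (k m : ℕ) : A.Total S →ₗ[ℝ] A.Total S where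
  toFun ω := WithLp.toLp 2 fun p => if (p.1 : ℕ) = k ∧ (p.2 : ℕ) = m then ω p else 0
  map_add' ω ω' := by ext p : 1; by_cases h : (p.1 : ℕ) = k ∧ (p.2 : ℕ) = m <;> simp [h]
  map_smul' c ω := by ext p : 1; by_cases h : (p.1 : ℕ) = k ∧ (p.2 : ℕ) = m <;> simp [h]

/-- A family of operators `E_k^{m+1} : Λ_{-1}^k(𝒯^m) → Λ_{-1}^k(𝒯^{m+1})`. -/
abbrev VertOps := ∀ k m : ℕ, A.Broken k m →ₗ[ℝ] A.Broken k (m + 1)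

/-- A family of operators `P_k^m : Λ_{-1}^{k+1}(𝒯^m) → Λ_{-1}^k(𝒯^m)`. -/
abbrev HorizOps := ∀ k m : ℕ, A.Broken (k + 1) m →ₗ[ℝ] A.Broken k m

/-- The operators `E_k^m` are generalized inverses of the operators `T_k^m`, i.e. `T E T = T`. -/
def IsVertInverse (E : A.VertOps) : Prop :=
  ∀ k m, A.Tv k m ∘ₗ E k m ∘ₗ A.Tv k m = A.Tv k m

/-- The operators `P_k^m` are generalized inverses of the operators `D_k^m`, i.e. `D P D = D`. -/
def IsHorizInverse (P : A.HorizOps) : Prop :=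
  ∀ k m, A.D k m ∘ₗ P k m ∘ₗ A.D k m = A.D k m

/-- The operators `E_k^m`, for all `k` and `m` at once. -/
def EE (E : A.VertOps) : A.Total S →ₗ[ℝ] A.Total S where
  toFun ω := WithLp.toLp 2 fun p => match p with
    | (_, ⟨0, _⟩) => 0
    | (k, ⟨m + 1, hm⟩) => A.lift S (E k m) (ω (k, ⟨m, by omega⟩))
  map_add' ω ω' := by
    ext ⟨k, ⟨_ | m, hm⟩⟩ : 1
    · exact (add_zero _).symm
    · exact (A.lift S (E k m)).map_add _ _
  map_smul' c ω := by
    ext ⟨k, ⟨_ | m, hm⟩⟩ : 1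
    · exact (smul_zero (A := A.HBroken S k 0) c).symm
    · exact (A.lift S (E k m)).map_smul _ _

/-- The operators `P_k^m`, for all `k` and `m` at once. -/
def PP (P : A.HorizOps) : A.Total S →ₗ[ℝ] A.Total S where
  toFun ω := WithLp.toLp 2 fun p =>
    if h : (p.1 : ℕ) < n then A.lift S (P p.1 p.2) (ω (⟨p.1 + 1, Nat.succ_lt_succ h⟩, p.2)) else 0
  map_add' ω ω' := by
    ext p : 1
    by_cases h : (p.1 : ℕ) < n <;> simp [h]
  map_smul' c ω := by
    ext p : 1
    by_cases h : (p.1 : ℕ) < n <;> simp [h]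

/-- The formula `ω ↦ ω - (-1)^{b+1} d E_{k-b+1}^{n-b+2} ω`, where `E_{k-b+1}^{n-b+2}` acts on the
component of `ω` in `Λ_{-1}^{k-b+1}(𝒯^{n-b+1})`. -/
def preR (E : A.VertOps) (k b : ℕ) : A.Total S →ₗ[ℝ] A.Total S :=
  LinearMap.id -
    (-1 : ℝ) ^ (b + 1) • (A.d S ∘ₗ A.EE S E ∘ₗ A.component S (k + 1 - b) (n + 1 - b))

/-- The formula `ω ↦ ω + (-1)^{b+n-m} d P_{b-2}^{m+b-1} ω`, where `P_{b-2}^{m+b-1}` acts on the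
component of `ω` in `Λ_{-1}^{b-1}(𝒯^{m+b-1})`. -/
def preS (P : A.HorizOps) (m b : ℕ) : A.Total S →ₗ[ℝ] A.Total S :=
  LinearMap.id +
    (-1 : ℝ) ^ (b + (n - m)) • (A.d S ∘ₗ A.PP S P ∘ₗ A.component S (b - 1) (m + b - 1))

theorem DD_mem {I J : Set (ℕ × ℕ)} (h : ∀ k m, (k, m) ∈ I → (k + 1, m) ∈ J) {ω : A.Total S}
    (hω : ω ∈ A.supported S I) : A.DD S ω ∈ A.supported S J := by
  rintro ⟨⟨_ | k, hk⟩, m⟩ hp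
  · rfl
  · have h0 : ω (⟨k, by omega⟩, m) = 0 := hω _ fun hI => hp (h _ _ hI)
    exact (congrArg (A.lift S (A.D k m)) h0).trans (A.lift S (A.D k m)).map_zero

theorem TT_mem {I J : Set (ℕ × ℕ)} (h : ∀ k m, (k, m + 1) ∈ I → (k, m) ∈ J) {ω : A.Total S}
    (hω : ω ∈ A.supported S I) : A.TT S ω ∈ A.supported S J := by
  intro p hp
  by_cases hm : (p.2 : ℕ) < n
  · have h0 : ω (p.1, ⟨p.2 + 1, Nat.succ_lt_succ hm⟩) = 0 := hω _ fun hI => hp (h _ _ hI)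
    exact (dif_pos hm).trans ((congrArg (A.lift S (A.Tv p.1 p.2)) h0).trans
      (A.lift S (A.Tv p.1 p.2)).map_zero)
  · exact dif_neg hm

theorem EE_mem (E : A.VertOps) {I J : Set (ℕ × ℕ)} (h : ∀ k m, (k, m) ∈ I → (k, m + 1) ∈ J)
    {ω : A.Total S} (hω : ω ∈ A.supported S I) : A.EE S E ω ∈ A.supported S J := by
  rintro ⟨k, ⟨_ | m, hm⟩⟩ hp
  · rfl
  · have h0 : ω (k, ⟨m, by omega⟩) = 0 := hω _ fun hI => hp (h _ _ hI)
    exact (congrArg (A.lift S (E k m)) h0).trans (A.lift S (E k m)).map_zero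

theorem PP_mem (P : A.HorizOps) {I J : Set (ℕ × ℕ)} (h : ∀ k m, (k + 1, m) ∈ I → (k, m) ∈ J)
    {ω : A.Total S} (hω : ω ∈ A.supported S I) : A.PP S P ω ∈ A.supported S J := by
  intro p hp
  by_cases hm : (p.1 : ℕ) < n
  · have h0 : ω (⟨p.1 + 1, Nat.succ_lt_succ hm⟩, p.2) = 0 := hω _ fun hI => hp (h _ _ hI)
    exact (dif_pos hm).trans ((congrArg (A.lift S (P p.1 p.2)) h0).trans
      (A.lift S (P p.1 p.2)).map_zero)
  · exact dif_neg hm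

theorem d_mem {I J : Set (ℕ × ℕ)} (hD : ∀ k m, (k, m) ∈ I → (k + 1, m) ∈ J)
    (hT : ∀ k m, (k, m + 1) ∈ I → (k, m) ∈ J) {ω : A.Total S}
    (hω : ω ∈ A.supported S I) : A.d S ω ∈ A.supported S J := by
  have h : A.sgn S ω ∈ A.supported S I := fun p hp => by simp [sgn, hω p hp]
  exact Submodule.sub_mem _ (A.DD_mem S hD h) (A.TT_mem S hT h)

theorem component_mem (k m : ℕ) (ω : A.Total S) :
    A.component S k m ω ∈ A.supported S {(k, m)} := by
  intro p hp
  have : ¬ ((p.1 : ℕ) = k ∧ (p.2 : ℕ) = m) := by simpa using hp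
  simp [component, this]

theorem preR_mem (E : A.VertOps) {k b : ℕ} (hb : 2 ≤ b) (hbk : b ≤ k + 1) (hk : k ≤ n)
    (ω : A.Total S) (hω : ω ∈ A.Lam S k n b) : A.preR S E k b ω ∈ A.Lam S k n b := by
  obtain ⟨b, rfl⟩ : ∃ c, b = c + 2 := ⟨b - 2, by omega⟩
  refine Submodule.sub_mem _ hω (Submodule.smul_mem _ _ ?_)
  refine A.d_mem S (I := {(k - (b + 1), n - b)}) ?_ ?_ (A.EE_mem S E ?_ (A.component_mem S _ _ ω))
  · rintro k' m h
    obtain ⟨rfl, rfl⟩ := Prod.mk.inj h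
    exact ⟨b, by omega, by push_cast; omega, by dsimp only; omega⟩
  · rintro k' m h
    obtain ⟨rfl, h2⟩ := Prod.mk.inj h
    exact ⟨b + 1, by omega, by push_cast; omega, by dsimp only; omega⟩
  · rintro k' m h
    obtain ⟨rfl, rfl⟩ := Prod.mk.inj h
    exact Prod.ext (by dsimp only; omega) (by dsimp only; omega)

theorem preS_mem (P : A.HorizOps) {m b : ℕ} (hb : 2 ≤ b)
    (ω : A.Total S) (hω : ω ∈ A.Gam S 0 m b) : A.preS S P m b ω ∈ A.Gam S 0 m b := by
  obtain ⟨b, rfl⟩ : ∃ c, b = c + 2 := ⟨b - 2, by omega⟩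
  refine Submodule.add_mem _ hω (Submodule.smul_mem _ _ ?_)
  refine A.d_mem S (I := {(b, m + (b + 1))}) ?_ ?_ (A.PP_mem S P ?_ (A.component_mem S _ _ ω))
  · rintro k' m' h
    obtain ⟨rfl, rfl⟩ := Prod.mk.inj h
    exact ⟨k' + 1, by omega, by dsimp only; omega, rfl⟩
  · rintro k' m' h
    obtain ⟨rfl, h2⟩ := Prod.mk.inj h
    exact ⟨k', by omega, by dsimp only; omega, by dsimp only; omega⟩
  · rintro k' m' h
    obtain ⟨h1, h2⟩ := Prod.mk.inj h
    exact Prod.ext (by dsimp only; omega) (by dsimp only; omega)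

/-- The regularizer `R_{k,b} : Λ_{-b}^k(𝒯^n) → Λ_{-b}^k(𝒯^n)`, for `2 ≤ b ≤ k + 1`. -/
def R (E : A.VertOps) {k b : ℕ} (hb : 2 ≤ b) (hbk : b ≤ k + 1) (hk : k ≤ n) :
    A.Lam S k n b →ₗ[ℝ] A.Lam S k n b :=
  (A.preR S E k b).restrict (A.preR_mem S E hb hbk hk)

/-- The regularizer `S_{m,b} : Γ_{-b}^0(𝒯^m) → Γ_{-b}^0(𝒯^m)`, for `2 ≤ b ≤ n - m + 1`. -/
def regS (P : A.HorizOps) (m : ℕ) {b : ℕ} (hb : 2 ≤ b) : A.Gam S 0 m b →ₗ[ℝ] A.Gam S 0 m b :=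
  (A.preS S P m b).restrict (A.preS_mem S P hb)

/-- The operator `Q_b^k R_{k,b}^*` on `Λ_{-b}^k(𝒯^n)`: the adjoint of `R_{k,b}`, followed by the
orthogonal projection `Q_b^k` onto the kernel of `d` in `Λ_{-b}^k(𝒯^n)`. -/
def QR (E : A.VertOps) {k b : ℕ} (hb : 2 ≤ b) (hbk : b ≤ k + 1) (hk : k ≤ n) :
    A.Lam S k n b →ₗ[ℝ] A.Lam S k n b :=
  (LinearMap.ker ((A.d S).domRestrict (A.Lam S k n b))).starProjection.toLinearMap ∘ₗ
    LinearMap.adjoint (A.R S E hb hbk hk)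

/-- The operator `Q_b^m S_{m,b}^*` on `Γ_{-b}^0(𝒯^m)`: the adjoint of `S_{m,b}`, followed by the
orthogonal projection `Q_b^m` onto the kernel of `d` in `Γ_{-b}^0(𝒯^m)`. -/
def QS (P : A.HorizOps) (m : ℕ) {b : ℕ} (hb : 2 ≤ b) : A.Gam S 0 m b →ₗ[ℝ] A.Gam S 0 m b :=
  (LinearMap.ker ((A.d S).domRestrict (A.Gam S 0 m b))).starProjection.toLinearMap ∘ₗ
    LinearMap.adjoint (A.regS S P m hb)

end FEComplex

end FEDist

namespace FEDist

namespace FEComplex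

variable {n : ℕ} (A : FEComplex n)

/-! The spaces $\Lambda_{-1}^k(\mathcal T^m)$ form a double complex: $\mathsf D$ raises the form
degree, $\mathsf T$ lowers the simplex dimension, both square to zero, and they commute. The sign in
$\mathbf d$ makes $\mathbf d^2=0$ (`d_d`). By local exactness the $\mathsf D$-sequences are exact in
positive degree, and in degree $0$ the kernel of $\mathsf D$ is spanned by indicators. The $\mathsf
T$-sequences are exact below dimension $n$, and in dimension $n$ the kernel of $\mathsf T$ is
$\Lambda^k_0(\mathcal T^n)$. The isomorphisms are the usual zigzag along the diagonal from $(0,n-k)$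
to $(k,n)$, performed one entry at a time and realized on harmonic representatives.

The geometric core is vertical exactness, `exists_Tv_eq`. Given $\omega\in\ker\mathsf T$, its traces
on faces are removed by induction on the number of vertices. Once the traces on all proper
subsimplices of $F$ vanish, the traces on $F$ form a relative cycle of $(\mathcal M_F,\mathcal N_F)$
with coefficients in $\mathring\Lambda^k(F)$ (`exists_bubble_filling`). The local patch condition
fills this cycle, and the extension operators spread the filling over the cells without disturbing
the traces already removed.

A single link of the chain works as follows. On closed forms, $R_{k,b}$ exchanges the component of
lowest dimension, $z_0$, for $\mathsf D\mathsf E z_0$ (`preR_of_closed`). It thus maps cycles into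
the shorter diagonal, changes them by boundaries only, and fixes what is already there. Hence it
inverts, on homology, the map induced by the inclusion of the shorter diagonal. A general Hilbert
space argument, `exists_equiv_projection_adjoint`, turns this into the statement that $QR^*$ is an
isomorphism of harmonic spaces. The operator $S_{m,b}$ does the same from the other end, with
$\mathsf D$ and $\mathsf P$ in place of $\mathsf T$ and $\mathsf E$ (`preS_of_closed`).

At full length $b=k+1$ both families consist of the entire diagonal, so the two harmonic spaces
coincide. At $b=1$ a form lives in a single dimension, so $\mathbf d\omega=0$ splits into $\mathsf
D\omega=0$ and $\mathsf T\omega=0$. Finally, on combinations of indicators $\mathsf T$ is the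
simplicial boundary operator, which gives the link to homology. -/

/-! ### Orientations and incidence numbers. -/

theorem finrank_dir {m : ℕ} (C : Face A.T m) : Module.finrank ℝ (Dir C.1) = m := by
  have h := (A.T.indep C.2.1).finrank_vectorSpan (n := m) (by simpa using C.2.2)
  have h1 : Set.range (Subtype.val : {x // x ∈ C.1} → Eucl n) = (C.1 : Set (Eucl n)) :=
    Subtype.range_coe
  rwa [h1] at h

/-- Otherwise `v` would lie in the affine span of `F`, against the affine independence of the
vertices of `C`. -/
theorem vsub_notMem_dir {C F : Finset (Eucl n)} (hC : C ∈ A.T.faces) (h : F ⊆ C) {p v : Eucl n}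
    (hp : p ∈ F) (hv : v ∈ C) (hvF : v ∉ F) : p -ᵥ v ∉ Dir F := by
  intro hmem
  have h1 : v ∈ affineSpan ℝ (F : Set (Eucl n)) := by
    have h2 := AffineSubspace.vadd_mem_of_mem_direction (s := affineSpan ℝ (F : Set (Eucl n)))
      (v := v -ᵥ p) (p := p) (by
        rw [direction_affineSpan, ← neg_vsub_eq_vsub_rev]; exact neg_mem hmem)
      (subset_affineSpan ℝ _ (Finset.mem_coe.2 hp))
    simpa using h2
  have h3 := (A.T.indep hC).mem_affineSpan_iff ⟨v, hv⟩ {x | x.1 ∈ F}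
  have h4 : (Subtype.val '' {x : {x // x ∈ C} | x.1 ∈ F}) = (F : Set (Eucl n)) := by
    ext x
    simp only [Set.mem_image, Set.mem_ofPred_eq, Subtype.exists, Finset.mem_coe]
    exact ⟨by rintro ⟨y, hy, hyF, rfl⟩; exact hyF, fun hx => ⟨x, h hx, hx, rfl⟩⟩
  rw [h4] at h3
  exact hvF (h3.1 h1)

/-- The restriction to a face `F` of `C` of the contraction of the orientation form of `C` with
the vector `p - v`. -/
def contraction {m : ℕ} (F : Face A.T m) (C : Face A.T (m + 1)) (h : F.1 ⊆ C.1) {p v : Eucl n}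
    (hp : p ∈ F.1) (hv : v ∈ C.1) : Dir F.1 [⋀^Fin m]→ₗ[ℝ] ℝ :=
  ((A.orient (m + 1) C).someVector.curryLeft (vec h hp hv)).compLinearMap
    (Submodule.inclusion (vectorSpan_mono ℝ (Finset.coe_subset.2 h)))

theorem contraction_apply {m : ℕ} (F : Face A.T m) (C : Face A.T (m + 1)) (h : F.1 ⊆ C.1)
    {p v : Eucl n} (hp : p ∈ F.1) (hv : v ∈ C.1) (w : Fin m → Dir F.1) :
    A.contraction F C h hp hv w = (A.orient (m + 1) C).someVector
      (Fin.cons (vec h hp hv)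
        fun i => Submodule.inclusion (vectorSpan_mono ℝ (Finset.coe_subset.2 h)) (w i)) := rfl

/-- The vector `p - v` together with a basis of `Dir F` is a basis of `Dir C`, so the contraction is
nonzero. Alternating forms of top degree on `Dir F` are multiples of each other. -/
theorem exists_contraction_eq_smul {m : ℕ} (F : Face A.T m) (C : Face A.T (m + 1)) (h : F.1 ⊆ C.1)
    {p v : Eucl n} (hp : p ∈ F.1) (hv : v ∈ C.1) (hvF : v ∉ F.1) :
    ∃ l : ℝ, l ≠ 0 ∧ A.contraction F C h hp hv = l • (A.orient m F).someVector := by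
  set ι := Submodule.inclusion (vectorSpan_mono ℝ (Finset.coe_subset.2 h)) with hι
  let e := Module.finBasisOfFinrankEq ℝ (Dir F.1) (A.finrank_dir F)
  have hind : LinearIndependent ℝ (Fin.cons (vec h hp hv) fun i => ι (e i) :
      Fin (m + 1) → Dir C.1) := by
    refine linearIndependent_finCons.2 ⟨e.linearIndependent.map' ι
      (Submodule.ker_inclusion _ _ _), fun hmem => ?_⟩
    have h1 : Submodule.span ℝ (Set.range fun i => ι (e i)) ≤ LinearMap.range ι := by
      rw [Submodule.span_le]; rintro _ ⟨i, rfl⟩; exact ⟨_, rfl⟩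
    obtain ⟨y, hy⟩ := h1 hmem
    refine A.vsub_notMem_dir C.2.1 h hp hv hvF ?_
    have h2 : (y : Eucl n) = p -ᵥ v := congrArg Subtype.val hy
    exact h2 ▸ y.2
  let e' := basisOfLinearIndependentOfCardEqFinrank hind
    (by rw [Fintype.card_fin]; exact (A.finrank_dir C).symm)
  have h1 : A.contraction F C h hp hv e ≠ 0 := by
    have h2 := (AlternatingMap.map_basis_ne_zero_iff e' (A.orient (m + 1) C).someVector).2
      (Module.Ray.someVector_ne_zero _)
    rwa [coe_basisOfLinearIndependentOfCardEqFinrank] at h2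
  have h2 : (A.orient m F).someVector e ≠ 0 :=
    (AlternatingMap.map_basis_ne_zero_iff e _).2 (Module.Ray.someVector_ne_zero _)
  refine ⟨A.contraction F C h hp hv e / (A.orient m F).someVector e, div_ne_zero h1 h2, ?_⟩
  rw [AlternatingMap.eq_smul_basis_det e (A.contraction F C h hp hv),
    AlternatingMap.eq_smul_basis_det e (A.orient m F).someVector]
  simp only [AlternatingMap.smul_apply, smul_smul, Module.Basis.det_self, smul_eq_mul, mul_one]
  rw [div_mul_cancel₀ _ h2]

/-- Changing `p` alters the contracted vector by an element of `Dir F`, and `m + 1` vectors of this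
`m`-dimensional space are dependent. -/
theorem contraction_congr {m : ℕ} (F : Face A.T m) (C : Face A.T (m + 1)) (h : F.1 ⊆ C.1)
    {p p' v : Eucl n} (hp : p ∈ F.1) (hp' : p' ∈ F.1) (hv : v ∈ C.1) :
    A.contraction F C h hp hv = A.contraction F C h hp' hv := by
  ext w
  set ι := Submodule.inclusion (vectorSpan_mono ℝ (Finset.coe_subset.2 h)) with hι
  let u : Dir F.1 := ⟨p -ᵥ p', vsub_mem_vectorSpan ℝ hp hp'⟩
  have hu : vec h hp hv = vec h hp' hv + ι u := by
    apply Subtype.ext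
    change p -ᵥ v = (p' -ᵥ v) + (p -ᵥ p')
    simp [vsub_eq_sub]
  have h0 : (A.orient (m + 1) C).someVector
      (Fin.cons (ι u) fun i => ι (w i) : Fin (m + 1) → Dir C.1) = 0 := by
    apply AlternatingMap.map_linearDependent
    intro hli
    have h1 : (Fin.cons (ι u) fun i => ι (w i) : Fin (m + 1) → Dir C.1) =
        ι ∘ (Fin.cons u w : Fin (m + 1) → Dir F.1) := by
      funext i; refine Fin.cases ?_ (fun j => ?_) i <;> simp
    rw [h1] at hli
    have h2 := (LinearIndependent.of_comp ι hli).fintype_card_le_finrank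
    rw [A.finrank_dir F, Fintype.card_fin] at h2
    omega
  have h3 := AlternatingMap.map_update_add (A.orient (m + 1) C).someVector
    (Fin.cons (ι u) fun i => ι (w i) : Fin (m + 1) → Dir C.1) 0 (vec h hp' hv) (ι u)
  simp only [Fin.update_cons_zero] at h3
  rw [contraction_apply, contraction_apply, hu]
  exact h3.trans (by rw [h0, add_zero])

theorem opposite_vertex_unique {m : ℕ} (F : Face A.T m) (C : Face A.T (m + 1)) (h : F.1 ⊆ C.1)
    {v v' : Eucl n} (hv : v ∈ C.1) (hvF : v ∉ F.1) (hv' : v' ∈ C.1) (hvF' : v' ∉ F.1) :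
    v = v' := by
  classical
  have h1 : (C.1 \ F.1).card = 1 := by
    rw [Finset.card_sdiff_of_subset h, C.2.2, F.2.2]; omega
  obtain ⟨x, hx⟩ := Finset.card_eq_one.1 h1
  have h2 : v ∈ C.1 \ F.1 := by simp [hv, hvF]
  have h3 : v' ∈ C.1 \ F.1 := by simp [hv', hvF']
  rw [hx, Finset.mem_singleton] at h2 h3
  rw [h2, h3]

/-- The choice of `p` and `v` in `InducesOrient` is immaterial: `v` is the only vertex of `C`
outside `F`, and `p` does not affect the contraction. Incidence numbers can therefore be computed
from any one choice. -/
theorem incidence_eq_sign {m : ℕ} (F : Face A.T m) (C : Face A.T (m + 1)) (h : F.1 ⊆ C.1)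
    {p v : Eucl n} (hp : p ∈ F.1) (hv : v ∈ C.1) (hvF : v ∉ F.1) {l : ℝ} (hl : l ≠ 0)
    (hc : A.contraction F C h hp hv = l • (A.orient m F).someVector) :
    A.incidence F C = SignType.sign l := by
  have key : A.InducesOrient F C h ↔ 0 < l := by
    rw [← sameRay_smul_left_iff_of_ne (Module.Ray.someVector_ne_zero (A.orient m F)) hl, ← hc]
    constructor
    · rintro ⟨p', hp', v', hv', hvF', hs⟩
      obtain rfl := A.opposite_vertex_unique F C h hv hvF hv' hvF'
      rw [A.contraction_congr F C h hp hp' hv]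
      exact hs
    · exact fun hs => ⟨p, hp, v, hv, hvF, hs⟩
  rw [incidence, dif_pos h]
  rcases hl.lt_or_gt with h0 | h0
  · rw [if_neg (by rw [key]; exact h0.not_gt), sign_neg h0]; simp
  · rw [if_pos (key.2 h0), sign_pos h0]; simp

theorem incidence_of_not_subset {m : ℕ} {F : Face A.T m} {C : Face A.T (m + 1)} (h : ¬ F.1 ⊆ C.1) :
    A.incidence F C = 0 := dif_neg h

/-- The two ways from `C` to a subsimplex of codimension two contribute with opposite signs. -/
theorem incidence_mul_incidence_add {m : ℕ} (G : Face A.T m) (F F' : Face A.T (m + 1))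
    (C : Face A.T (m + 2)) (hF : F.1 ⊆ C.1) (hF' : F'.1 ⊆ C.1) (hG : G.1 ⊆ F.1) (hG' : G.1 ⊆ F'.1)
    (hne : F.1 ≠ F'.1) :
    A.incidence G F * A.incidence F C + A.incidence G F' * A.incidence F' C = 0 := by
  have hcard : F.1.card = F'.1.card := F.2.2.trans F'.2.2.symm
  obtain ⟨a, haF, haF'⟩ := Finset.not_subset.1
    fun hs => hne (Finset.eq_of_subset_of_card_le hs hcard.ge)
  obtain ⟨b, hbF', hbF⟩ := Finset.not_subset.1
    fun hs => hne (Finset.eq_of_subset_of_card_le hs hcard.le).symm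
  obtain ⟨p, hp⟩ : G.1.Nonempty := Finset.card_pos.1 (by rw [G.2.2]; omega)
  have haG : a ∉ G.1 := fun h => haF' (hG' h)
  have hbG : b ∉ G.1 := fun h => hbF (hG h)
  obtain ⟨l1, hl1, e1⟩ := A.exists_contraction_eq_smul F C hF (hG hp) (hF' hbF') hbF
  obtain ⟨l2, hl2, e2⟩ := A.exists_contraction_eq_smul G F hG hp haF haG
  obtain ⟨l3, hl3, e3⟩ := A.exists_contraction_eq_smul F' C hF' (hG' hp) (hF haF) haF'
  obtain ⟨l4, hl4, e4⟩ := A.exists_contraction_eq_smul G F' hG' hp hbF' hbG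
  rw [A.incidence_eq_sign F C hF (hG hp) (hF' hbF') hbF hl1 e1,
    A.incidence_eq_sign G F hG hp haF haG hl2 e2,
    A.incidence_eq_sign F' C hF' (hG' hp) (hF haF) haF' hl3 e3,
    A.incidence_eq_sign G F' hG' hp hbF' hbG hl4 e4]
  -- Here `F` is `G` with the vertex `a` added, and `F'` is `G` with `b` added. Both products come
  -- from the orientation form of `C`, evaluated at `(p - b, p - a, w)` and at `(p - a, p - b, w)`;
  -- swapping the first two arguments changes the sign.
  have hanti : ∀ w : Fin m → Dir G.1,
      l1 * (l2 * (A.orient m G).someVector w) = -(l3 * (l4 * (A.orient m G).someVector w)) := by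
    intro w
    have f1 := DFunLike.congr_fun e1 (Fin.cons (vec hG hp haF)
      fun i => Submodule.inclusion (vectorSpan_mono ℝ (Finset.coe_subset.2 hG)) (w i))
    have f2 := DFunLike.congr_fun e2 w
    have f3 := DFunLike.congr_fun e3 (Fin.cons (vec hG' hp hbF')
      fun i => Submodule.inclusion (vectorSpan_mono ℝ (Finset.coe_subset.2 hG')) (w i))
    have f4 := DFunLike.congr_fun e4 w
    rw [contraction_apply, AlternatingMap.smul_apply, smul_eq_mul] at f1 f2 f3 f4
    rw [← f2, ← f4, ← f1, ← f3]
    have hsw := AlternatingMap.map_swap (A.orient (m + 2) C).someVector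
      (Fin.cons (vec hF' (hG' hp) (hF haF)) fun i =>
        Submodule.inclusion (vectorSpan_mono ℝ (Finset.coe_subset.2 hF'))
          ((Fin.cons (vec hG' hp hbF') fun i =>
            Submodule.inclusion (vectorSpan_mono ℝ (Finset.coe_subset.2 hG')) (w i) :
              Fin (m + 1) → Dir F'.1) i) : Fin (m + 2) → Dir C.1) (i := 0) (j := 1) (by simp)
    rw [← hsw]
    congr 1
    funext i
    refine Fin.cases ?_ (fun i => Fin.cases ?_ (fun i => ?_) i) i
    · simp [Function.comp]; rfl
    · simp [Function.comp]; rfl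
    · have h0 : Equiv.swap (0 : Fin (m + 2)) 1 i.succ.succ = i.succ.succ :=
        Equiv.swap_apply_of_ne_of_ne (by simp) (Fin.succ_succ_ne_one i)
      simp only [Function.comp, Fin.cons_succ, h0]
      rfl
  obtain ⟨w, hw⟩ : ∃ w, (A.orient m G).someVector w ≠ 0 := by
    by_contra! h
    exact Module.Ray.someVector_ne_zero (A.orient m G) (AlternatingMap.ext h)
  have h5 : l2 * l1 = -(l4 * l3) := by
    have h6 := hanti w
    have h7 : (l2 * l1) * (A.orient m G).someVector w = -(l4 * l3) * (A.orient m G).someVector w := by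
      linarith
    exact mul_right_cancel₀ hw h7
  have h8 : (SignType.sign l2 * SignType.sign l1 : SignType) =
      -(SignType.sign l4 * SignType.sign l3) := by
    rw [← sign_mul, ← sign_mul, h5, Left.sign_neg]
  have h9 := congrArg (fun s : SignType => (s : ℝ)) h8
  simp only [SignType.coe_mul, SignType.coe_neg] at h9
  rw [h9]; ring

/-- If `G ⊆ C`, exactly two simplices lie strictly between them, one for each vertex of `C` outside
`G`. Neither belongs to `𝒰`, because `𝒰` is closed under passing to faces and `G ∉ 𝒰`, so both occur
in the sum. -/
theorem sum_incidence_mul_incidence {m : ℕ} (G : A.Cell m) (C : A.Cell (m + 2)) :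
    ∑ F : A.Cell (m + 1), A.incidence G.1 F.1 * A.incidence F.1 C.1 = 0 := by
  classical
  by_cases hGC : G.1.1 ⊆ C.1.1
  swap
  · refine Finset.sum_eq_zero fun F _ => ?_
    by_cases h1 : G.1.1 ⊆ F.1.1
    · rw [A.incidence_of_not_subset (F := F.1) fun h2 => hGC (h1.trans h2), mul_zero]
    · rw [A.incidence_of_not_subset h1, zero_mul]
  have h1 : (C.1.1 \ G.1.1).card = 2 := by
    rw [Finset.card_sdiff_of_subset hGC, C.1.2.2, G.1.2.2]; omega
  obtain ⟨a, b, hab, hs⟩ := Finset.card_eq_two.1 h1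
  have haC : a ∈ C.1.1 ∧ a ∉ G.1.1 := by
    have : a ∈ C.1.1 \ G.1.1 := by simp [hs]
    simpa using this
  have hbC : b ∈ C.1.1 ∧ b ∉ G.1.1 := by
    have : b ∈ C.1.1 \ G.1.1 := by simp [hs]
    simpa using this
  have hGne : G.1.1.Nonempty := Finset.card_pos.1 (by rw [G.1.2.2]; omega)
  have mk : ∀ x, x ∈ C.1.1 → x ∉ G.1.1 → ∃ F : A.Cell (m + 1), F.1.1 = insert x G.1.1 := by
    intro x hx hxG
    refine ⟨⟨⟨insert x G.1.1, A.T.down_closed C.1.2.1 (Finset.insert_subset hx hGC)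
      (Finset.insert_nonempty _ _), by rw [Finset.card_insert_of_notMem hxG, G.1.2.2]⟩,
      A.T.down_closed C.1.2.1 (Finset.insert_subset hx hGC)
      (Finset.insert_nonempty _ _), fun hU => G.2.2 ?_⟩, rfl⟩
    exact A.U.down_closed hU (Finset.subset_insert _ _) hGne
  obtain ⟨Fa, hFa⟩ := mk a haC.1 haC.2
  obtain ⟨Fb, hFb⟩ := mk b hbC.1 hbC.2
  have hne : Fa.1.1 ≠ Fb.1.1 := by
    rw [hFa, hFb]
    intro h
    have : a ∈ insert b G.1.1 := h ▸ Finset.mem_insert_self a _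
    rcases Finset.mem_insert.1 this with h | h
    · exact hab h
    · exact haC.2 h
  rw [Finset.sum_eq_add Fa Fb (fun h => hne (by rw [h]))]
  · exact A.incidence_mul_incidence_add G.1 Fa.1 Fb.1 C.1
      (by rw [hFa]; exact Finset.insert_subset haC.1 hGC)
      (by rw [hFb]; exact Finset.insert_subset hbC.1 hGC)
      (by rw [hFa]; exact Finset.subset_insert _ _) (by rw [hFb]; exact Finset.subset_insert _ _) hne
  · rintro F - ⟨hF1, hF2⟩
    by_cases hGF : G.1.1 ⊆ F.1.1
    swap
    · rw [A.incidence_of_not_subset hGF, zero_mul]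
    by_cases hFC : F.1.1 ⊆ C.1.1
    swap
    · rw [A.incidence_of_not_subset hFC, mul_zero]
    exfalso
    have h2 : (F.1.1 \ G.1.1).card = 1 := by
      rw [Finset.card_sdiff_of_subset hGF, F.1.2.2, G.1.2.2]; omega
    obtain ⟨x, hx⟩ := Finset.card_eq_one.1 h2
    have hFx : F.1.1 = insert x G.1.1 := by
      rw [← Finset.sdiff_union_of_subset hGF, hx]; rfl
    have hx' : x ∈ C.1.1 \ G.1.1 := by
      have : x ∈ F.1.1 \ G.1.1 := by simp [hx]
      exact Finset.sdiff_subset_sdiff hFC le_rfl this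
    rw [hs, Finset.mem_insert, Finset.mem_singleton] at hx'
    rcases hx' with rfl | rfl
    · exact hF1 (Subtype.ext (Subtype.ext (hFx.trans hFa.symm)))
    · exact hF2 (Subtype.ext (Subtype.ext (hFx.trans hFb.symm)))
  · simp
  · simp

end FEComplex

/-! ### Traces, exterior derivatives and indicators on simplices. -/

section Forms

variable {n k : ℕ}

theorem trace_trace {G F C : Finset (Eucl n)} (h : G ⊆ F) (h' : F ⊆ C) (ω : SmoothForm k C) :
    trace k h (trace k h' ω) = trace k (h.trans h') ω := rfl

theorem trace_dForm {F C : Finset (Eucl n)} (h : F ⊆ C) (ω : SmoothForm k C) :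
    trace (k + 1) h (dForm k C ω) = dForm k F (trace k h ω) := by
  obtain ⟨η, hη, e⟩ := ω.2
  have h1 := dForm_eq ω hη e
  have h2 := dForm_eq (trace k h ω) hη (congrArg (FormField.restrict h) e)
  exact Subtype.ext ((congrArg (FormField.restrict h) h1).trans h2.symm)

theorem dForm_dForm {C : Finset (Eucl n)} (ω : SmoothForm k C) :
    dForm (k + 1) C (dForm k C ω) = 0 := by
  obtain ⟨η, hη, e⟩ := ω.2
  apply Subtype.ext
  rw [dForm_eq (dForm k C ω) (contDiff_extDeriv hη) (dForm_eq ω hη e),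
    extDeriv_extDeriv hη (by rw [minSmoothness_of_isRCLikeNormedField]; exact WithTop.coe_le_coe.2 (le_top : (2 : ℕ∞) ≤ ⊤))]
  rfl

theorem trace_indicator {F C : Finset (Eucl n)} (h : F ⊆ C) :
    trace 0 h (indicator C) = indicator F := rfl

/-- Forms of degree greater than `n` vanish. -/
theorem smoothForm_eq_zero (hk : n < k) {C : Finset (Eucl n)} (ω : SmoothForm k C) : ω = 0 := by
  apply Subtype.ext
  funext x
  apply ContinuousAlternatingMap.ext
  intro v
  refine AlternatingMap.map_linearDependent ((ω : FormField k C) x).toAlternatingMap v fun h => ?_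
  have h1 := h.fintype_card_le_finrank
  have h2 := Submodule.finrank_le (Dir C)
  rw [Fintype.card_fin] at h1
  rw [finrank_euclideanSpace, Fintype.card_fin] at h2
  omega

end Forms

/-! ### Exactness of the vertical and horizontal sequences. -/

/-- If the kernel of a linear map is contained in the range of a matrix, then the same holds for
the vector-valued versions. -/
theorem exists_valued_preimage {ι κ V : Type*} [Fintype ι] [AddCommGroup V] [Module ℝ V]
    [FiniteDimensional ℝ V] (M : κ → ι → ℝ) (v : κ → V)
    (h : ∀ φ : V →ₗ[ℝ] ℝ, ∃ u : ι → ℝ, ∀ x, ∑ i, M x i * u i = φ (v x)) :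
    ∃ u : ι → V, ∀ x, ∑ i, M x i • u i = v x := by
  -- The scalar systems for the coordinate functionals of a basis are solved separately and the
  -- solutions recombined.
  let b := Module.finBasis ℝ V
  choose u hu using fun i => h (b.coord i)
  refine ⟨fun i => ∑ j, u j i • b j, fun x => ?_⟩
  simp only [Finset.smul_sum, smul_smul]
  rw [Finset.sum_comm]
  simp only [← Finset.sum_smul, hu]
  exact b.sum_repr (v x)

namespace FEComplex

variable {n : ℕ} (A : FEComplex n)

theorem card_le {C : Finset (Eucl n)} (hC : C ∈ A.T.faces) : C.card ≤ n + 1 := by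
  obtain ⟨C', _, h, hc⟩ := A.exists_supersimplex C hC
  exact hc ▸ Finset.card_le_card h

open Classical in
theorem coe_Tv {k m : ℕ} (ω : A.Broken k (m + 1)) (F : A.Cell m) :
    (A.Tv k m ω F : SmoothForm k F.1.1) = ∑ C : A.Cell (m + 1), if h : F.1.1 ⊆ C.1.1 then
      A.incidence F.1 C.1 • trace k h (ω C : SmoothForm k C.1.1) else 0 := by
  change ((∑ C : A.Cell (m + 1), _ : A.space k F.1.1) : SmoothForm k F.1.1) = _
  rw [AddSubmonoidClass.coe_finsetSum]
  refine Finset.sum_congr rfl fun C _ => ?_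
  split_ifs <;> rfl

theorem Tv_Tv {k m : ℕ} (ω : A.Broken k (m + 2)) : A.Tv k m (A.Tv k (m + 1) ω) = 0 := by
  classical
  funext G
  apply Subtype.ext
  rw [coe_Tv]
  have h1 : ∀ F : A.Cell (m + 1), (if h : G.1.1 ⊆ F.1.1 then
      A.incidence G.1 F.1 • trace k h (A.Tv k (m + 1) ω F : SmoothForm k F.1.1) else 0) =
      ∑ C : A.Cell (m + 2), if h : G.1.1 ⊆ C.1.1 then
        (A.incidence G.1 F.1 * A.incidence F.1 C.1) •
          trace k h (ω C : SmoothForm k C.1.1) else 0 := by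
    intro F
    split_ifs with h
    · rw [coe_Tv, map_sum, Finset.smul_sum]
      refine Finset.sum_congr rfl fun C _ => ?_
      by_cases hFC : F.1.1 ⊆ C.1.1
      · rw [dif_pos hFC, dif_pos (h.trans hFC), map_smul, smul_smul, trace_trace]
      · rw [dif_neg hFC, map_zero, smul_zero, A.incidence_of_not_subset hFC]
        split_ifs <;> simp
    · rw [A.incidence_of_not_subset h]
      simp
  rw [Finset.sum_congr rfl fun F _ => h1 F, Finset.sum_comm]
  refine Finset.sum_eq_zero fun C _ => ?_
  split_ifs with h
  · rw [← Finset.sum_smul, A.sum_incidence_mul_incidence, zero_smul]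
  · simp

theorem D_D {k m : ℕ} (ω : A.Broken k m) : A.D (k + 1) m (A.D k m ω) = 0 := by
  funext C
  exact Subtype.ext (dForm_dForm _)

theorem D_Tv {k m : ℕ} (ω : A.Broken k (m + 1)) :
    A.D k m (A.Tv k m ω) = A.Tv (k + 1) m (A.D k (m + 1) ω) := by
  classical
  funext F
  apply Subtype.ext
  rw [coe_Tv]
  change dForm k F.1.1 (A.Tv k m ω F : SmoothForm k F.1.1) = _
  rw [coe_Tv, map_sum]
  refine Finset.sum_congr rfl fun C _ => ?_
  split_ifs with h
  · rw [map_smul, ← trace_dForm]; rfl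
  · exact map_zero _

/-- The kernel of the vertical differential; it is the whole space in dimension `0`. -/
def vertKer (k : ℕ) : (m : ℕ) → Submodule ℝ (A.Broken k m)
  | 0 => ⊤
  | m + 1 => LinearMap.ker (A.Tv k m)

theorem Tv_mem_vertKer {k m : ℕ} (ω : A.Broken k (m + 1)) : A.Tv k m ω ∈ A.vertKer k m := by
  cases m with
  | zero => trivial
  | succ m => exact A.Tv_Tv ω

/-- With `relFace_patch_of_subset`, this identifies the relative simplices of the patch, in
dimensions below `n`, with the cells that contain `F`. In dimension `n` it would fail: `𝒩_F` has no
`n`-simplices, so those of `𝒰` around `F` survive. -/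
theorem subset_of_mem_relFace_patch {F : Finset (Eucl n)} {m : ℕ} (hm : m < n)
    (C : A.RelFace (A.patch F) (A.patchBdry F) m) : F ⊆ C.1.1 ∧ C.1.1 ∉ A.U.faces := by
  have h : ¬ (¬ F ⊆ C.1.1 ∨ C.1.1 ∈ A.U.faces) := fun h => C.2.2 ⟨C.2.1, by rw [C.1.2.2]; omega, h⟩
  rw [not_or, not_not] at h
  exact h

theorem relFace_patch_of_subset {F : Finset (Eucl n)} {m : ℕ} (C : A.Cell m) (h : F ⊆ C.1.1) :
    C.1.1 ∈ A.patch F ∧ C.1.1 ∉ A.patchBdry F := by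
  obtain ⟨C', hC', hs, hc⟩ := A.exists_supersimplex C.1.1 C.1.2.1
  exact ⟨⟨C.1.2.1, C', hC', hc, h.trans hs, hs⟩, fun hN => hN.2.2.elim (fun h' => h' h) C.2.2⟩

theorem exists_bdry_eq_of_patch (hpatch : A.LocalPatch) {F : Finset (Eucl n)} (hF : F ∈ A.T.faces)
    {m : ℕ} (hm : m < n) (c : A.Chain (A.patch F) (A.patchBdry F) m)
    (hc : c ∈ A.cycles (A.patch F) (A.patchBdry F) m) :
    ∃ u, A.bdry (A.patch F) (A.patchBdry F) m u = c := by
  have h := hpatch F hF m hm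
  rw [Submodule.Quotient.subsingleton_iff, Submodule.submoduleOf_eq_top] at h
  exact h hc

/-- By `h0` the traces of `ω` on `F` are bubbles. Tracing the equation `T ω = 0` further to `F` says
that they form a relative cycle of the patch of `F` with values in the bubble space; the local patch
condition, applied coordinatewise, makes it a boundary. -/
theorem exists_bubble_filling (hpatch : A.LocalPatch) {F : Finset (Eucl n)} (hF : F ∈ A.T.faces)
    {k m : ℕ} (hm : m < n) (ω : A.Broken k m) (hω : ω ∈ A.vertKer k m)
    (h0 : ∀ C : A.Cell m, ∀ G ∈ A.T.faces, ∀ h : G ⊆ C.1.1, G ⊂ F →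
      trace k h (ω C : SmoothForm k C.1.1) = 0) :
    ∃ u : A.Cell (m + 1) → A.bubble k F, ∀ C : A.Cell m, ∀ h : F ⊆ C.1.1,
      ∑ C' : A.Cell (m + 1), A.incidence C.1 C'.1 • (u C' : SmoothForm k F) =
        trace k h (ω C : SmoothForm k C.1.1) := by
  classical
  have : FiniteDimensional ℝ (A.space k F) := A.finiteDimensional k F hF
  have : FiniteDimensional ℝ (A.bubble k F) :=
    Submodule.finiteDimensional_of_le (S₂ := A.space k F) inf_le_left
  let cell : A.RelFace (A.patch F) (A.patchBdry F) m → A.Cell m :=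
    fun C => ⟨C.1, C.1.2.1, (A.subset_of_mem_relFace_patch hm C).2⟩
  have hmem : ∀ C : A.RelFace (A.patch F) (A.patchBdry F) m,
      trace k (A.subset_of_mem_relFace_patch hm C).1 (ω (cell C) : SmoothForm k C.1.1) ∈
        A.bubble k F := by
    intro C
    refine ⟨?_, ?_⟩
    · exact A.map_trace k C.1.1 C.1.2.1 F hF (A.subset_of_mem_relFace_patch hm C).1 ▸
        Submodule.mem_map_of_mem (ω (cell C)).2
    · simp only [SetLike.mem_coe, Submodule.mem_iInf, LinearMap.mem_ker]
      intro G hG h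
      exact h0 (cell C) G hG (h.subset.trans (A.subset_of_mem_relFace_patch hm C).1) h
  let c : A.RelFace (A.patch F) (A.patchBdry F) m → A.bubble k F := fun C => ⟨_, hmem C⟩
  have hcyc : ∀ φ : A.bubble k F →ₗ[ℝ] ℝ,
      (fun C => φ (c C)) ∈ A.cycles (A.patch F) (A.patchBdry F) m := by
    intro φ
    cases m with
    | zero => trivial
    | succ m =>
      funext G
      change ∑ C, A.incidence G.1 C.1 * φ (c C) = 0
      have hG := A.subset_of_mem_relFace_patch (by omega) G
      have h1 : ∑ C, A.incidence G.1 C.1 • c C = 0 := by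
        apply Subtype.ext
        rw [AddSubmonoidClass.coe_finsetSum]
        -- `G` contains `F` and is not in `𝒰`, so `T ω` has a component on it. Every cell around `G`
        -- also contains `F` and hence belongs to the patch, so no term of that component is lost.
        let G' : A.Cell m := ⟨G.1, G.1.2.1, hG.2⟩
        have h2 := congrArg (fun ξ : A.Broken k m => trace k hG.1 (ξ G' : SmoothForm k G.1.1))
          (show A.Tv k m ω = 0 from hω)
        simp only [coe_Tv, map_sum] at h2
        refine Eq.trans ?_ (h2.trans (map_zero _))
        refine Fintype.sum_of_injective cell
          (fun C C' h => Subtype.ext (congrArg (fun X : A.Cell (m + 1) => X.1) h)) _ _ ?_ ?_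
        · intro C hC
          rw [dif_neg, map_zero]
          intro h
          obtain ⟨h3, h4⟩ := A.relFace_patch_of_subset C (hG.1.trans h)
          exact hC ⟨⟨C.1, h3, h4⟩, rfl⟩
        · intro C
          by_cases h : G.1.1 ⊆ C.1.1
          · rw [dif_pos (show G'.1.1 ⊆ (cell C).1.1 from h), map_smul]
            rfl
          · rw [dif_neg (show ¬ G'.1.1 ⊆ (cell C).1.1 from h), map_zero,
              A.incidence_of_not_subset h, zero_smul]
            rfl
      have h3 := congrArg φ h1
      simpa using h3
  obtain ⟨u, hu⟩ := exists_valued_preimage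
    (fun (C : A.RelFace (A.patch F) (A.patchBdry F) m)
      (C' : A.RelFace (A.patch F) (A.patchBdry F) (m + 1)) => A.incidence C.1 C'.1) c fun φ => by
    obtain ⟨u, hu⟩ := A.exists_bdry_eq_of_patch hpatch hF hm _ (hcyc φ)
    exact ⟨u, fun C => congrFun hu C⟩
  -- The default value `0` is harmless: a cell that does not contain `F` is not a supersimplex of
  -- any `C ⊇ F`, so its incidence number with `C` vanishes.
  refine ⟨fun C' => if h : F ⊆ C'.1.1 then u ⟨C'.1, A.relFace_patch_of_subset C' h⟩ else 0,
    fun C h => ?_⟩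
  have h1 := hu ⟨C.1, A.relFace_patch_of_subset C h⟩
  have h2 := congrArg Subtype.val h1
  rw [AddSubmonoidClass.coe_finsetSum] at h2
  refine Eq.trans ?_ h2
  have hsub : ∀ {C' : Face A.T (m + 1)}, ¬ F ⊆ C'.1 → A.incidence C.1 C' = 0 :=
    fun h' => A.incidence_of_not_subset fun h'' => h' (h.trans h'')
  trans ∑ C' : {C' : A.Cell (m + 1) // F ⊆ C'.1.1},
    A.incidence C.1 C'.1.1 • (u ⟨C'.1.1, A.relFace_patch_of_subset C'.1 C'.2⟩ : SmoothForm k F)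
  · symm
    refine Fintype.sum_of_injective (fun C' => C'.1) Subtype.val_injective _ _ ?_ ?_
    · intro C' hC'
      rw [hsub fun h' => hC' ⟨⟨C', h'⟩, rfl⟩, zero_smul]
    · intro C'
      dsimp only
      rw [dif_pos C'.2]
  · refine Fintype.sum_of_injective
      (fun C' : {C' : A.Cell (m + 1) // F ⊆ C'.1.1} =>
        (⟨C'.1.1, A.relFace_patch_of_subset C'.1 C'.2⟩ :
          A.RelFace (A.patch F) (A.patchBdry F) (m + 1)))
      (fun C' C'' h' => Subtype.ext (Subtype.ext (congrArg
        (fun X : A.RelFace (A.patch F) (A.patchBdry F) (m + 1) => X.1) h'))) _ _ ?_ ?_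
    · intro C' hC'
      -- Such a `C'` can only be an `n`-simplex of `𝒰`. It does not contain `C`, since `𝒰` is closed
      -- under faces and `C ∉ 𝒰`.
      have h3 : A.incidence C.1 C'.1 = 0 := by
        by_cases hCC : C.1.1 ⊆ C'.1.1
        · exact absurd ⟨⟨⟨C'.1, C'.1.2.1, fun hU => C.2.2 (A.U.down_closed hU hCC
            (Finset.card_pos.1 (by rw [C.1.2.2]; omega)))⟩, h.trans hCC⟩, rfl⟩ hC'
        · exact A.incidence_of_not_subset hCC
      change (A.incidence C.1 C'.1 • (u C' : A.bubble k F) : SmoothForm k F) = 0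
      rw [h3, zero_smul]
    · intro C'
      rfl

/-- Induction on the number of vertices of the faces on which the trace is to vanish. In each step
the fillings for all `F` with `j` vertices are extended to the cells and summed; the extension from
`F` has zero trace on every simplex that does not contain `F`, so the steps do not interfere. -/
theorem exists_sub_Tv_trace_eq_zero (hgeom : A.GeometricDecomposition) (hpatch : A.LocalPatch)
    {k m : ℕ} (hm : m < n) (ω : A.Broken k m) (hω : ω ∈ A.vertKer k m) (j : ℕ) :
    ∃ η : A.Broken k (m + 1), ∀ C : A.Cell m, ∀ G ∈ A.T.faces, ∀ h : G ⊆ C.1.1, G.card < j →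
      trace k h ((ω - A.Tv k m η) C : SmoothForm k C.1.1) = 0 := by
  classical
  induction j with
  | zero => exact ⟨0, fun _ _ _ _ h => absurd h (by omega)⟩
  | succ j ih =>
    obtain ⟨η, hη⟩ := ih
    set ξ := ω - A.Tv k m η with hξ
    have hξm : ξ ∈ A.vertKer k m := Submodule.sub_mem _ hω (A.Tv_mem_vertKer η)
    obtain ⟨ext, hext⟩ := hgeom
    -- Stated for all finite sets, with the value `0` where the conditions on `F` fail, so that the
    -- fillings can be chosen simultaneously.
    have hfill : ∀ F : Finset (Eucl n), ∃ u : A.Cell (m + 1) → A.bubble k F,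
        F ∈ A.T.faces → F.card = j → ∀ C : A.Cell m, ∀ h : F ⊆ C.1.1,
        ∑ C' : A.Cell (m + 1), A.incidence C.1 C'.1 • (u C' : SmoothForm k F) =
        trace k h (ξ C : SmoothForm k C.1.1) := by
      intro F
      by_cases hF : F ∈ A.T.faces ∧ F.card = j
      · obtain ⟨u, hu⟩ := A.exists_bubble_filling hpatch hF.1 hm ξ hξm fun C G hG h hGF =>
          hη C G hG h (hF.2 ▸ Finset.card_lt_card hGF)
        exact ⟨u, fun _ _ => hu⟩
      · exact ⟨0, fun h1 h2 => absurd ⟨h1, h2⟩ hF⟩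
    choose u hu using hfill
    let fc : A.Cell (m + 1) → Finset (Finset (Eucl n)) := fun C' =>
      A.finite_faces.toFinset.filter fun F => F.card = j ∧ F ⊆ C'.1.1
    have hfc : ∀ {C' : A.Cell (m + 1)} {F}, F ∈ fc C' ↔
        F ∈ A.T.faces ∧ F.card = j ∧ F ⊆ C'.1.1 := by
      intro C' F
      simp [fc]
    let ζ : A.Broken k (m + 1) := fun C' => ⟨∑ F ∈ fc C', ext k F C'.1.1 (u F C'), by
      refine Submodule.sum_mem _ fun F hF => ?_
      obtain ⟨h1, -, h3⟩ := hfc.1 hF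
      exact (hext k F h1 C'.1.1 C'.1.2.1 h3 _).1⟩
    have hζ : ∀ C' : A.Cell (m + 1), ∀ H ∈ A.T.faces, ∀ h : H ⊆ C'.1.1, H.card < j + 1 →
        trace k h (ζ C' : SmoothForm k C'.1.1) = if H.card = j then (u H C' : SmoothForm k H)
          else 0 := by
      intro C' H hH h hc
      change trace k h (∑ F ∈ fc C', ext k F C'.1.1 (u F C')) = _
      rw [map_sum]
      -- As `H` has at most `j` vertices and `F` has exactly `j`, the inclusion `F ⊆ H` would force
      -- `F = H`.
      have hz : ∀ F ∈ fc C', F ≠ H → trace k h (ext k F C'.1.1 (u F C')) = 0 := by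
        intro F hF hne
        obtain ⟨h1, h2, h3⟩ := hfc.1 hF
        refine ((hext k F h1 C'.1.1 C'.1.2.1 h3 (u F C')).2.2 H hH h).2 fun hs => hne ?_
        exact Finset.eq_of_subset_of_card_le hs (by omega)
      split_ifs with hcj
      · have hHm : H ∈ fc C' := hfc.2 ⟨hH, hcj, h⟩
        rw [Finset.sum_eq_single_of_mem H hHm hz]
        exact (hext k H hH C'.1.1 C'.1.2.1 h (u H C')).2.1
      · refine Finset.sum_eq_zero fun F hF => hz F hF ?_
        rintro rfl
        exact hcj (hfc.1 hF).2.1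
    refine ⟨η + ζ, fun C H hH h hc => ?_⟩
    have h1 : ω - A.Tv k m (η + ζ) = ξ - A.Tv k m ζ := by rw [map_add, hξ]; abel
    rw [h1]
    change trace k h ((ξ C : SmoothForm k C.1.1) - (A.Tv k m ζ C : SmoothForm k C.1.1)) = 0
    rw [map_sub, coe_Tv, map_sum]
    have h2 : ∀ C' : A.Cell (m + 1), trace k h (if h : C.1.1 ⊆ C'.1.1 then
        A.incidence C.1 C'.1 • trace k h (ζ C' : SmoothForm k C'.1.1) else 0) =
        A.incidence C.1 C'.1 • (if H.card = j then (u H C' : SmoothForm k H) else 0) := by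
      intro C'
      by_cases hs : C.1.1 ⊆ C'.1.1
      · rw [dif_pos hs, map_smul, trace_trace, hζ C' H hH (h.trans hs) hc]
      · rw [dif_neg hs, map_zero, A.incidence_of_not_subset hs, zero_smul]
    rw [Finset.sum_congr rfl fun C' _ => h2 C']
    split_ifs with hcj
    · rw [hu H hH hcj C h, sub_self]
    · rw [hη C H hH h (by omega)]
      simp

/-- The vertical sequences are exact below dimension `n`. -/
theorem exists_Tv_eq (hgeom : A.GeometricDecomposition) (hpatch : A.LocalPatch)
    {k m : ℕ} (hm : m < n) (ω : A.Broken k m) (hω : ω ∈ A.vertKer k m) :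
    ∃ η, A.Tv k m η = ω := by
  -- An `m`-simplex has `m + 1 < m + 2` vertices, so the trace of each component on its own simplex,
  -- which is the component itself, vanishes.
  obtain ⟨η, hη⟩ := A.exists_sub_Tv_trace_eq_zero hgeom hpatch hm ω hω (m + 2)
  refine ⟨η, ?_⟩
  symm
  rw [← sub_eq_zero]
  funext C
  exact Subtype.ext (hη C C.1.1 C.1.2.1 le_rfl (by rw [C.1.2.2]; omega))

theorem exists_D_eq (hexact : A.LocalExactness) {k m : ℕ} (ω : A.Broken (k + 1) m)
    (hω : A.D (k + 1) m ω = 0) : ∃ η, A.D k m η = ω := by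
  have h : ∀ C : A.Cell m, ∃ η : A.space k C.1.1, A.dd k C.1.2.1 η = ω C := by
    intro C
    obtain ⟨η, h1, h2⟩ := (hexact C.1.1 C.1.2.1 C.2.2).2 k (ω C) (ω C).2
      (congrArg Subtype.val (congrFun hω C))
    exact ⟨⟨η, h1⟩, Subtype.ext h2⟩
  choose η hη using h
  exact ⟨η, funext hη⟩

end FEComplex

/-! ### The double complex on the total space. -/

namespace FEComplex

variable {n : ℕ} (A : FEComplex n) (S : A.ScalarProducts)

theorem TT_apply_of_lt (ω : A.Total S) (k : Fin (n + 1)) {m : ℕ} (hm : m < n) :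
    A.TT S ω (k, ⟨m, by omega⟩) = A.lift S (A.Tv k m) (ω (k, ⟨m + 1, by omega⟩)) :=
  dif_pos hm

theorem TT_apply_top (ω : A.Total S) (k : Fin (n + 1)) {m : Fin (n + 1)} (hm : ¬ (m : ℕ) < n) :
    A.TT S ω (k, m) = 0 :=
  dif_neg hm

theorem DD_apply_succ (ω : A.Total S) {k : ℕ} (hk : k < n) (m : Fin (n + 1)) :
    A.DD S ω (⟨k + 1, by omega⟩, m) = A.lift S (A.D k m) (ω (⟨k, by omega⟩, m)) := rfl

theorem EE_apply_succ (E : A.VertOps) (ω : A.Total S) (k : Fin (n + 1)) {m : ℕ} (hm : m < n) :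
    A.EE S E ω (k, ⟨m + 1, by omega⟩) = A.lift S (E k m) (ω (k, ⟨m, by omega⟩)) := rfl

theorem PP_apply_of_lt (P : A.HorizOps) (ω : A.Total S) {k : ℕ} (hk : k < n) (m : Fin (n + 1)) :
    A.PP S P ω (⟨k, by omega⟩, m) = A.lift S (P k m) (ω (⟨k + 1, by omega⟩, m)) :=
  dif_pos hk

theorem sgn_apply (ω : A.Total S) (p : Fin (n + 1) × Fin (n + 1)) :
    A.sgn S ω p = (-1 : ℝ) ^ (n - (p.2 : ℕ)) • ω p := rfl

theorem DD_DD (ω : A.Total S) : A.DD S (A.DD S ω) = 0 := by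
  ext ⟨⟨_ | _ | k, hk⟩, m⟩ : 1
  · rfl
  · exact (A.lift S (A.D 0 m)).map_zero
  · exact A.D_D _

theorem TT_TT (ω : A.Total S) : A.TT S (A.TT S ω) = 0 := by
  ext ⟨k, m⟩ : 1
  by_cases hm : (m : ℕ) < n
  · refine (A.TT_apply_of_lt S _ k hm).trans ?_
    by_cases hm' : (m : ℕ) + 1 < n
    · rw [A.TT_apply_of_lt S _ k hm']
      exact A.Tv_Tv _
    · rw [A.TT_apply_top S _ k (m := ⟨(m : ℕ) + 1, _⟩) hm', map_zero]
      rfl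
  · exact A.TT_apply_top S _ k hm

theorem DD_TT (ω : A.Total S) : A.DD S (A.TT S ω) = A.TT S (A.DD S ω) := by
  ext ⟨⟨_ | k, hk⟩, m⟩ : 1
  · by_cases hm : (m : ℕ) < n
    · refine Eq.trans ?_ (A.TT_apply_of_lt S _ _ hm).symm
      exact ((A.lift S (A.Tv 0 m)).map_zero).symm
    · exact (A.TT_apply_top S _ _ hm).symm
  · by_cases hm : (m : ℕ) < n
    · refine Eq.trans ?_ (A.TT_apply_of_lt S _ _ hm).symm
      refine (congrArg (A.lift S (A.D k m)) (A.TT_apply_of_lt S ω ⟨k, by omega⟩ hm)).trans ?_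
      exact A.D_Tv _
    · refine Eq.trans ?_ (A.TT_apply_top S _ _ hm).symm
      exact (congrArg (A.lift S (A.D k m)) (A.TT_apply_top S ω ⟨k, by omega⟩ hm)).trans (map_zero _)

theorem sgn_sgn (ω : A.Total S) : A.sgn S (A.sgn S ω) = ω := by
  ext p : 1
  rw [sgn_apply, sgn_apply, smul_smul, ← mul_pow]
  simp

theorem DD_sgn (ω : A.Total S) : A.DD S (A.sgn S ω) = A.sgn S (A.DD S ω) := by
  ext ⟨⟨_ | k, hk⟩, m⟩ : 1
  · exact (smul_zero (A := A.HBroken S 0 m) _).symm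
  · exact (A.lift S (A.D k m)).map_smul _ _

theorem TT_sgn (ω : A.Total S) : A.TT S (A.sgn S ω) = - A.sgn S (A.TT S ω) := by
  ext ⟨k, m⟩ : 1
  change _ = - A.sgn S (A.TT S ω) (k, m)
  rw [sgn_apply]
  by_cases hm : (m : ℕ) < n
  · have h1 : A.TT S ω (k, m) = _ := A.TT_apply_of_lt S ω k hm
    have h2 : A.TT S (A.sgn S ω) (k, m) = _ := A.TT_apply_of_lt S _ k hm
    rw [h1, h2, sgn_apply, map_smul, ← neg_smul]
    congr 1
    have h3 : n - (m : ℕ) = (n - ((m : ℕ) + 1)) + 1 := by omega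
    change (-1 : ℝ) ^ (n - ((m : ℕ) + 1)) = - (-1 : ℝ) ^ (n - (m : ℕ))
    rw [h3, pow_succ]
    ring
  · rw [A.TT_apply_top S _ k hm, A.TT_apply_top S _ k hm, smul_zero, neg_zero]

theorem d_apply (ω : A.Total S) : A.d S ω = A.DD S (A.sgn S ω) - A.TT S (A.sgn S ω) := rfl

/-- The sign operator commutes with `D` and anticommutes with `T`, so the square of `d` is `(D -
T)(D + T)`, which vanishes because `D` and `T` commute and square to zero. -/
theorem d_d (ω : A.Total S) : A.d S (A.d S ω) = 0 := by
  simp only [d_apply, map_sub, DD_sgn, TT_sgn, sgn_sgn, DD_DD, TT_TT, DD_TT, map_neg]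
  simp

theorem TT_EE_TT {E : A.VertOps} (hE : A.IsVertInverse E) (ω : A.Total S) :
    A.TT S (A.EE S E (A.TT S ω)) = A.TT S ω := by
  ext ⟨k, m⟩ : 1
  by_cases hm : (m : ℕ) < n
  · refine (A.TT_apply_of_lt S _ k hm).trans (Eq.trans ?_ (A.TT_apply_of_lt S _ k hm).symm)
    rw [A.EE_apply_succ S E _ k hm, A.TT_apply_of_lt S _ k hm]
    exact LinearMap.congr_fun (hE k m) _
  · exact (A.TT_apply_top S _ k hm).trans (A.TT_apply_top S _ k hm).symm

theorem DD_PP_DD {P : A.HorizOps} (hP : A.IsHorizInverse P) (ω : A.Total S) :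
    A.DD S (A.PP S P (A.DD S ω)) = A.DD S ω := by
  ext ⟨⟨_ | k, hk⟩, m⟩ : 1
  · rfl
  · refine (congrArg (A.lift S (A.D k m)) (A.PP_apply_of_lt S P _ (by omega) m)).trans ?_
    exact LinearMap.congr_fun (hP k m) _

/-! ### Components -/

theorem component_apply (k m : ℕ) (ω : A.Total S) (p : Fin (n + 1) × Fin (n + 1)) :
    A.component S k m ω p = if (p.1 : ℕ) = k ∧ (p.2 : ℕ) = m then ω p else 0 := rfl

theorem mem_supported_iff {I : Set (ℕ × ℕ)} {ω : A.Total S} :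
    ω ∈ A.supported S I ↔ ∀ k m, (k, m) ∉ I → A.component S k m ω = 0 := by
  constructor
  · intro h k m hkm
    ext p : 1
    rw [component_apply]
    split_ifs with hp
    · exact h p (by rwa [hp.1, hp.2])
    · rfl
  · intro h p hp
    have h1 := congrArg (fun η : A.Total S => η p) (h _ _ hp)
    simpa [component_apply] using h1

theorem component_of_mem {k m : ℕ} {ω : A.Total S} (h : ω ∈ A.supported S {(k, m)}) :
    A.component S k m ω = ω := by
  ext p : 1
  rw [component_apply]
  split_ifs with hp
  · rfl
  · refine (h p fun h' => hp ?_).symm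
    exact ⟨congrArg Prod.fst h', congrArg Prod.snd h'⟩

theorem supported_mono {I J : Set (ℕ × ℕ)} (h : I ⊆ J) : A.supported S I ≤ A.supported S J :=
  fun _ hω p hp => hω p fun h' => hp (h h')

theorem sub_component_mem {I J : Set (ℕ × ℕ)} {k m : ℕ} (h : ∀ q ∈ I, q ≠ (k, m) → q ∈ J)
    {ω : A.Total S} (hω : ω ∈ A.supported S I) : ω - A.component S k m ω ∈ A.supported S J := by
  intro p hp
  change ω p - A.component S k m ω p = 0
  rw [component_apply]
  split_ifs with hq
  · exact sub_self _
  · rw [sub_zero]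
    exact hω p fun hI => hp (h _ hI fun h' => hq ⟨congrArg Prod.fst h', congrArg Prod.snd h'⟩)

theorem component_TT (k m : ℕ) (ω : A.Total S) :
    A.component S k m (A.TT S ω) = A.TT S (A.component S k (m + 1) ω) := by
  ext ⟨k', m'⟩ : 1
  rw [component_apply]
  by_cases hm : (m' : ℕ) < n
  · refine Eq.trans ?_ (A.TT_apply_of_lt S _ k' hm).symm
    rw [component_apply]
    by_cases hp : (k' : ℕ) = k ∧ (m' : ℕ) = m
    · rw [if_pos hp, if_pos (by exact ⟨hp.1, by dsimp only; rw [hp.2]⟩)]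
      exact A.TT_apply_of_lt S _ k' hm
    · rw [if_neg hp, if_neg fun h => hp ⟨h.1, Nat.succ.inj h.2⟩, map_zero]
  · refine Eq.trans ?_ (A.TT_apply_top S _ k' hm).symm
    rw [A.TT_apply_top S _ k' hm, ite_self]

theorem TT_component_zero (k : ℕ) (ω : A.Total S) : A.TT S (A.component S k 0 ω) = 0 := by
  ext ⟨k', m'⟩ : 1
  by_cases hm : (m' : ℕ) < n
  · refine (A.TT_apply_of_lt S _ k' hm).trans ?_
    rw [component_apply, if_neg fun h => Nat.succ_ne_zero _ h.2, map_zero]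
    rfl
  · exact A.TT_apply_top S _ k' hm

theorem component_DD_succ (k m : ℕ) (ω : A.Total S) :
    A.component S (k + 1) m (A.DD S ω) = A.DD S (A.component S k m ω) := by
  ext ⟨⟨_ | k', hk⟩, m'⟩ : 1
  · rw [component_apply]
    exact ite_self _
  · rw [component_apply, A.DD_apply_succ S _ (by omega), A.DD_apply_succ S _ (by omega),
      component_apply]
    by_cases hp : k' = k ∧ (m' : ℕ) = m
    · rw [if_pos hp, if_pos (by exact ⟨congrArg Nat.succ hp.1, hp.2⟩)]
    · rw [if_neg hp, if_neg fun h => hp ⟨Nat.succ.inj h.1, h.2⟩, map_zero]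

theorem component_DD_zero (m : ℕ) (ω : A.Total S) : A.component S 0 m (A.DD S ω) = 0 := by
  ext ⟨⟨_ | k', hk⟩, m'⟩ : 1
  · rw [component_apply]
    exact ite_self _
  · rw [component_apply, if_neg fun h => Nat.succ_ne_zero _ h.1]
    rfl

theorem sgn_of_mem {I : Set (ℕ × ℕ)} {m : ℕ} (hI : ∀ q ∈ I, q.2 = m) {ω : A.Total S}
    (h : ω ∈ A.supported S I) : A.sgn S ω = (-1 : ℝ) ^ (n - m) • ω := by
  ext p : 1
  rw [sgn_apply]
  change _ = (-1 : ℝ) ^ (n - m) • ω p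
  by_cases hp : ((p.1 : ℕ), (p.2 : ℕ)) ∈ I
  · have h1 : (-1 : ℝ) ^ (n - (p.2 : ℕ)) = (-1 : ℝ) ^ (n - m) :=
      congrArg (fun i => (-1 : ℝ) ^ (n - i)) (hI _ hp)
    rw [h1]
  · rw [h p hp, smul_zero, smul_zero]

theorem d_of_mem {I : Set (ℕ × ℕ)} {m : ℕ} (hI : ∀ q ∈ I, q.2 = m) {ω : A.Total S}
    (h : ω ∈ A.supported S I) : A.d S ω = (-1 : ℝ) ^ (n - m) • (A.DD S ω - A.TT S ω) := by
  rw [d_apply, A.sgn_of_mem S hI h, map_smul, map_smul, smul_sub]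

theorem component_sgn (k m : ℕ) (ω : A.Total S) :
    A.component S k m (A.sgn S ω) = (-1 : ℝ) ^ (n - m) • A.component S k m ω := by
  rw [← A.sgn_of_mem S (fun q hq => congrArg Prod.snd hq) (A.component_mem S k m ω)]
  ext p : 1
  rw [component_apply, sgn_apply, sgn_apply, component_apply]
  split_ifs
  · rfl
  · rw [smul_zero]

theorem smul_pow_eq_zero {V : Type*} [AddCommGroup V] [Module ℝ V] {i : ℕ} {x : V}
    (h : (-1 : ℝ) ^ i • x = 0) : x = 0 :=
  (smul_eq_zero.1 h).resolve_left (pow_ne_zero _ (by norm_num))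

/-- If no component of `ω` reaches `(k, m)` horizontally, the vertical part of `d ω` is isolated. -/
theorem TT_component_eq_zero {k m : ℕ} {ω : A.Total S} (hd : A.component S k m (A.d S ω) = 0)
    (h : ∀ k', k = k' + 1 → A.component S k' m ω = 0) : A.TT S (A.component S k (m + 1) ω) = 0 := by
  have h1 : A.component S k m (A.DD S (A.sgn S ω)) = 0 := by
    cases k with
    | zero => exact A.component_DD_zero S m _
    | succ k => rw [component_DD_succ, component_sgn, h k rfl, smul_zero, map_zero]
  rw [d_apply, map_sub, h1, zero_sub, neg_eq_zero, component_TT, component_sgn, map_smul] at hd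
  exact smul_pow_eq_zero hd

/-- If no component of `ω` reaches `(k + 1, m)` vertically, the horizontal part of `d ω` is
isolated. -/
theorem DD_component_eq_zero {k m : ℕ} {ω : A.Total S}
    (hd : A.component S (k + 1) m (A.d S ω) = 0) (h : A.component S (k + 1) (m + 1) ω = 0) :
    A.DD S (A.component S k m ω) = 0 := by
  rw [d_apply, map_sub, component_TT, component_sgn, h, smul_zero, map_zero, sub_zero,
    component_DD_succ, component_sgn, map_smul] at hd
  exact smul_pow_eq_zero hd

/-! ### Embedding of the individual spaces -/

/-- The embedding of `Λ_{-1}^k(𝒯^m)` into the space of all forms. -/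
def single {k m : ℕ} (hk : k ≤ n) (hm : m ≤ n) : A.Broken k m →ₗ[ℝ] A.Total S where
  toFun x := WithLp.toLp 2
    (Pi.single (⟨k, Nat.lt_succ_of_le hk⟩, ⟨m, Nat.lt_succ_of_le hm⟩) (A.toH S k m x))
  map_add' x y := congrArg (WithLp.toLp 2)
    (Pi.single_add (f := fun p : Fin (n + 1) × Fin (n + 1) => A.HBroken S p.1 p.2)
      (⟨k, Nat.lt_succ_of_le hk⟩, ⟨m, Nat.lt_succ_of_le hm⟩) (A.toH S k m x) (A.toH S k m y))
  map_smul' c x := congrArg (WithLp.toLp 2)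
    (Pi.single_smul (f := fun p : Fin (n + 1) × Fin (n + 1) => A.HBroken S p.1 p.2)
      (⟨k, Nat.lt_succ_of_le hk⟩, ⟨m, Nat.lt_succ_of_le hm⟩) c (A.toH S k m x))

theorem single_apply_same {k m : ℕ} (hk : k ≤ n) (hm : m ≤ n) (x : A.Broken k m) :
    A.single S hk hm x (⟨k, Nat.lt_succ_of_le hk⟩, ⟨m, Nat.lt_succ_of_le hm⟩) = A.toH S k m x :=
  Pi.single_eq_same (M := fun p : Fin (n + 1) × Fin (n + 1) => A.HBroken S p.1 p.2) _ _

theorem single_apply_of_ne {k m : ℕ} (hk : k ≤ n) (hm : m ≤ n) (x : A.Broken k m)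
    {p : Fin (n + 1) × Fin (n + 1)} (hp : ((p.1 : ℕ), (p.2 : ℕ)) ≠ (k, m)) :
    A.single S hk hm x p = 0 := by
  refine Pi.single_eq_of_ne (M := fun p : Fin (n + 1) × Fin (n + 1) => A.HBroken S p.1 p.2) ?_ _
  rintro rfl
  exact hp rfl

theorem single_mem {k m : ℕ} (hk : k ≤ n) (hm : m ≤ n) (x : A.Broken k m) :
    A.single S hk hm x ∈ A.supported S {(k, m)} :=
  fun _ hp => A.single_apply_of_ne S hk hm x hp

theorem single_injective {k m : ℕ} (hk : k ≤ n) (hm : m ≤ n) :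
    Function.Injective (A.single S hk hm : A.Broken k m → A.Total S) := by
  intro x y h
  have h1 := congrArg (fun η : A.Total S =>
    η (⟨k, Nat.lt_succ_of_le hk⟩, ⟨m, Nat.lt_succ_of_le hm⟩)) h
  simp only [single_apply_same] at h1
  exact h1

theorem exists_eq_single {k m : ℕ} (hk : k ≤ n) (hm : m ≤ n) {ω : A.Total S}
    (h : ω ∈ A.supported S {(k, m)}) : ∃ x, ω = A.single S hk hm x := by
  refine ⟨ω (⟨k, Nat.lt_succ_of_le hk⟩, ⟨m, Nat.lt_succ_of_le hm⟩), ?_⟩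
  ext p : 1
  by_cases hp : ((p.1 : ℕ), (p.2 : ℕ)) = (k, m)
  · obtain ⟨⟨k', hk'⟩, ⟨m', hm'⟩⟩ := p
    obtain ⟨rfl, rfl⟩ := Prod.mk.inj hp
    exact (A.single_apply_same S hk hm _).symm
  · exact (h p hp).trans (A.single_apply_of_ne S hk hm _ hp).symm

theorem TT_single {k m : ℕ} (hk : k ≤ n) (hm : m + 1 ≤ n) (x : A.Broken k (m + 1)) :
    A.TT S (A.single S hk hm x) = A.single S hk (Nat.le_of_succ_le hm) (A.Tv k m x) := by
  ext ⟨⟨k', hk'⟩, ⟨m', hm'⟩⟩ : 1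
  by_cases h : m' < n
  · refine (A.TT_apply_of_lt S _ ⟨k', hk'⟩ h).trans ?_
    by_cases hp : (k', m') = (k, m)
    · obtain ⟨rfl, rfl⟩ := Prod.mk.inj hp
      rw [A.single_apply_same S hk hm]
      exact (A.single_apply_same S hk _ _).symm
    · rw [A.single_apply_of_ne S hk _ _ (p := (⟨k', hk'⟩, ⟨m', hm'⟩)) hp,
        A.single_apply_of_ne S hk hm, map_zero]
      intro h'
      obtain ⟨h1, h2⟩ := Prod.mk.inj h'
      exact hp (Prod.ext h1 (Nat.succ.inj h2))
  · rw [A.TT_apply_top S _ ⟨k', hk'⟩ (m := ⟨m', hm'⟩) h, A.single_apply_of_ne S hk]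
    intro h'
    have h2 : m' = m := (Prod.mk.inj h').2
    omega

theorem DD_single {k m : ℕ} (hk : k + 1 ≤ n) (hm : m ≤ n) (x : A.Broken k m) :
    A.DD S (A.single S (Nat.le_of_succ_le hk) hm x) = A.single S hk hm (A.D k m x) := by
  ext ⟨⟨_ | k', hk'⟩, ⟨m', hm'⟩⟩ : 1
  · rw [A.single_apply_of_ne S hk]
    · rfl
    · exact fun h' => absurd (Prod.mk.inj h').1 (Nat.succ_ne_zero _).symm
  · rw [A.DD_apply_succ S _ (by omega)]
    by_cases hp : (k', m') = (k, m)
    · obtain ⟨rfl, rfl⟩ := Prod.mk.inj hp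
      rw [A.single_apply_same S _ hm, A.single_apply_same S _ hm]
      rfl
    · rw [A.single_apply_of_ne S (Nat.le_of_succ_le hk) hm x
        (p := (⟨k', by omega⟩, ⟨m', hm'⟩)) hp, A.single_apply_of_ne S hk hm, map_zero]
      intro h'
      obtain ⟨h1, h2⟩ := Prod.mk.inj h'
      exact hp (Prod.ext (Nat.succ.inj h1) h2)

/-- The total space stops at form degree `n`. Since there are no nonzero forms of higher degree,
this truncation does not enlarge the kernel of `D`. -/
theorem D_top {k m : ℕ} (hk : n ≤ k) (x : A.Broken k m) : A.D k m x = 0 := by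
  funext C
  exact Subtype.ext (smoothForm_eq_zero (Nat.lt_succ_of_le hk) _)

theorem D_eq_zero_of_DD_single {k m : ℕ} (hk : k ≤ n) (hm : m ≤ n) {x : A.Broken k m}
    (h : A.DD S (A.single S hk hm x) = 0) : A.D k m x = 0 := by
  rcases hk.lt_or_eq with h1 | h1
  · rw [A.DD_single S h1 hm] at h
    apply A.single_injective S h1 hm
    rw [h, map_zero]
  · exact A.D_top h1.ge x

theorem mem_vertKer_of_TT_single {k m : ℕ} (hk : k ≤ n) (hm : m ≤ n) {x : A.Broken k m}
    (h : A.TT S (A.single S hk hm x) = 0) : x ∈ A.vertKer k m := by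
  cases m with
  | zero => trivial
  | succ m =>
    rw [A.TT_single S hk hm] at h
    apply A.single_injective S hk (Nat.le_of_succ_le hm)
    rw [h, map_zero]

theorem eq_zero_of_mem_supported {k m : ℕ} (h : n < k ∨ n < m) {ω : A.Total S}
    (hω : ω ∈ A.supported S {(k, m)}) : ω = 0 := by
  ext ⟨⟨k', hk'⟩, ⟨m', hm'⟩⟩ : 1
  refine hω _ fun h' => ?_
  have h1 : k' = k := (Prod.mk.inj h').1
  have h2 : m' = m := (Prod.mk.inj h').2
  omega

theorem exists_TT_eq (hgeom : A.GeometricDecomposition) (hpatch : A.LocalPatch) {k m : ℕ}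
    (hm : m < n) {ω : A.Total S} (hω : ω ∈ A.supported S {(k, m)}) (h : A.TT S ω = 0) :
    ∃ η ∈ A.supported S {(k, m + 1)}, A.TT S η = ω := by
  by_cases hk : k ≤ n
  swap
  · exact ⟨0, zero_mem _, by rw [map_zero, A.eq_zero_of_mem_supported S (Or.inl (not_le.1 hk)) hω]⟩
  obtain ⟨x, rfl⟩ := A.exists_eq_single S hk hm.le hω
  obtain ⟨y, rfl⟩ := A.exists_Tv_eq hgeom hpatch hm x (A.mem_vertKer_of_TT_single S hk hm.le h)
  exact ⟨_, A.single_mem S hk hm y, A.TT_single S hk hm y⟩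

theorem exists_DD_eq (hexact : A.LocalExactness) {k m : ℕ} {ω : A.Total S}
    (hω : ω ∈ A.supported S {(k + 1, m)}) (h : A.DD S ω = 0) :
    ∃ η ∈ A.supported S {(k, m)}, A.DD S η = ω := by
  by_cases hkm : n < k + 1 ∨ n < m
  · exact ⟨0, zero_mem _, by rw [map_zero, A.eq_zero_of_mem_supported S hkm hω]⟩
  rw [not_or, not_lt, not_lt] at hkm
  obtain ⟨x, rfl⟩ := A.exists_eq_single S hkm.1 hkm.2 hω
  obtain ⟨y, rfl⟩ := A.exists_D_eq hexact x (A.D_eq_zero_of_DD_single S hkm.1 hkm.2 h)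
  exact ⟨_, A.single_mem S _ hkm.2 y, A.DD_single S hkm.1 hkm.2 y⟩

end FEComplex
-- Projected adjoints as isomorphisms of harmonic spaces.
open scoped InnerProductSpace in
/-- Let `R` map the cycles in `X` to cycles in the smaller space `X'`, moving them by boundaries
only. Then the adjoint of `R`, projected to the cycles in `X`, is an isomorphism between the
harmonic spaces. -/
theorem exists_equiv_projection_adjoint {H : Type*} [NormedAddCommGroup H] [InnerProductSpace ℝ H]
    [FiniteDimensional ℝ H] (d : H →ₗ[ℝ] H) {X X' Y Y' : Submodule ℝ H} (hX : X' ≤ X)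
    (hYX : ∀ y ∈ Y, d y ∈ X) (hYX' : ∀ y ∈ Y', d y ∈ X') (hY : Y' ≤ Y) (hd : ∀ x, d (d x) = 0)
    (R : X →ₗ[ℝ] X)
    (hR : ∀ z : X, d z = 0 → (R z : H) ∈ X' ∧ (z - R z : H) ∈ Y.map d)
    (hRX : ∀ z : X, (z : H) ∈ X' → R z = z)
    (hdY : ∀ y ∈ Y, d y ∈ X' → ∃ y' ∈ Y', d y' = d y) :
    ∃ e : (X' ⊓ LinearMap.ker d ⊓ (Y'.map d)ᗮ : Submodule ℝ H) ≃ₗ[ℝ]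
        (X ⊓ LinearMap.ker d ⊓ (Y.map d)ᗮ : Submodule ℝ H),
      ∀ h : (X' ⊓ LinearMap.ker d ⊓ (Y'.map d)ᗮ : Submodule ℝ H), ∃ hh : (h : H) ∈ X, (e h : H) =
        ((LinearMap.ker (d.domRestrict X)).starProjection.toLinearMap ∘ₗ
          LinearMap.adjoint R) ⟨h, hh⟩ := by
  set K := LinearMap.ker (d.domRestrict X)
  let f : X →ₗ[ℝ] X := K.starProjection.toLinearMap ∘ₗ LinearMap.adjoint R
  have hfK : ∀ x, f x ∈ K := fun x => K.starProjection_apply_mem _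
  -- Tested against cycles, the projection is invisible and `f` acts as the adjoint of `R`.
  -- Everything below rests on this identity.
  have hf : ∀ x : X, ∀ z : X, d z = 0 → ⟪f x, z⟫_ℝ = ⟪x, R z⟫_ℝ := by
    intro x z hz
    change ⟪K.starProjection (LinearMap.adjoint R x), z⟫_ℝ = _
    rw [Submodule.inner_starProjection_left_eq_right,
      Submodule.starProjection_eq_self_iff.2 (show z ∈ K from hz), LinearMap.adjoint_inner_left]
  have hdR : ∀ z : X, d z = 0 → d (R z) = 0 := by
    intro z hz
    obtain ⟨y, -, hy⟩ := (hR z hz).2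
    have h1 := congrArg d hy
    rw [hd, map_sub, hz, zero_sub] at h1
    exact neg_eq_zero.1 h1.symm
  -- `R` both preserves and reflects boundaries: `z` and `R z` differ by an element of `d Y`, and
  -- elements of `d Y` that lie in `X'` already belong to `d Y'`.
  have hbd : ∀ z : X, d z = 0 → ((z : H) ∈ Y.map d ↔ (R z : H) ∈ Y'.map d) := by
    intro z hz
    have h2 := (hR z hz).2
    constructor
    · intro h1
      have h3 : (R z : H) ∈ Y.map d := by simpa using Submodule.sub_mem _ h1 h2
      obtain ⟨y, hy, e⟩ := h3
      obtain ⟨y', hy', e'⟩ := hdY y hy (e ▸ (hR z hz).1)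
      exact ⟨y', hy', e'.trans e⟩
    · intro h1
      simpa using Submodule.add_mem _ h2 (Submodule.map_mono hY h1)
  have hmem : ∀ h : (X' ⊓ LinearMap.ker d ⊓ (Y'.map d)ᗮ : Submodule ℝ H),
      (f ⟨h, hX h.2.1.1⟩ : H) ∈ X ⊓ LinearMap.ker d ⊓ (Y.map d)ᗮ := by
    intro h
    refine ⟨⟨(f _).2, hfK _⟩, (Submodule.mem_orthogonal' _ _).2 fun b hb => ?_⟩
    obtain ⟨y, hy, rfl⟩ := hb
    have h1 := hf ⟨h, hX h.2.1.1⟩ ⟨d y, hYX y hy⟩ (hd y)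
    have h2 := (hbd ⟨d y, hYX y hy⟩ (hd y)).1 ⟨y, hy, rfl⟩
    exact h1.trans ((Submodule.mem_orthogonal' _ _).1 h.2.2 _ h2)
  let g : (X' ⊓ LinearMap.ker d ⊓ (Y'.map d)ᗮ : Submodule ℝ H) →ₗ[ℝ]
      (X ⊓ LinearMap.ker d ⊓ (Y.map d)ᗮ : Submodule ℝ H) :=
    { toFun := fun h => ⟨f ⟨h, hX h.2.1.1⟩, hmem h⟩
      map_add' := fun h h' => Subtype.ext (congrArg (Subtype.val : X → H)
        (f.map_add ⟨h, hX h.2.1.1⟩ ⟨h', hX h'.2.1.1⟩))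
      map_smul' := fun c h => Subtype.ext (congrArg (Subtype.val : X → H)
        (f.map_smul c ⟨h, hX h.2.1.1⟩)) }
  have hinj : Function.Injective g := by
    rw [← LinearMap.ker_eq_bot, LinearMap.ker_eq_bot']
    intro h hg
    have h0 : f ⟨h, hX h.2.1.1⟩ = 0 := by
      have h1 : ((g h : (X ⊓ LinearMap.ker d ⊓ (Y.map d)ᗮ : Submodule ℝ H)) : H) = 0 := by
        rw [hg]; rfl
      exact Subtype.ext h1
    -- Since `R` fixes `h`, the inner product of `f h` with `h` is the squared norm of `h`.
    have h1 := hf ⟨h, hX h.2.1.1⟩ ⟨h, hX h.2.1.1⟩ h.2.1.2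
    rw [h0, inner_zero_left, hRX ⟨h, hX h.2.1.1⟩ h.2.1.1] at h1
    exact Subtype.ext (congrArg (Subtype.val : X → H) (inner_self_eq_zero.1 h1.symm))
  have hsurj : Function.Surjective g := by
    -- If a harmonic `w` is orthogonal to the range, then `R w` is orthogonal to the harmonic space
    -- of `X'`. Being a cycle, it is then a boundary; hence so is `w`, which is orthogonal to
    -- boundaries.
    rw [← LinearMap.range_eq_top, ← Submodule.orthogonal_eq_bot_iff, Submodule.eq_bot_iff]
    intro w hw
    have hwd : d w = 0 := w.2.1.2
    have h1 : ∀ h : (X' ⊓ LinearMap.ker d ⊓ (Y'.map d)ᗮ : Submodule ℝ H),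
        ⟪(h : H), ((R ⟨w, w.2.1.1⟩ : X) : H)⟫_ℝ = 0 := by
      intro h
      have h2 := (Submodule.mem_orthogonal _ _).1 hw (g h) ⟨h, rfl⟩
      exact (hf ⟨h, hX h.2.1.1⟩ ⟨w, w.2.1.1⟩ hwd).symm.trans h2
    have h2 : ((R ⟨w, w.2.1.1⟩ : X) : H) ∈ Y'.map d := by
      -- With `q` the projection of `r` onto the boundaries, `r - q` is harmonic, so it is
      -- orthogonal to `r` as well as to `q`, and thus to itself.
      set r : H := (R ⟨w, w.2.1.1⟩).1
      set q : H := (Y'.map d).starProjection r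
      have hqm : q ∈ Y'.map d := Submodule.starProjection_apply_mem _ _
      have hqX : q ∈ X' ∧ d q = 0 := by
        obtain ⟨y, hy, e⟩ := hqm
        rw [← e]
        exact ⟨hYX' y hy, hd y⟩
      have h3 : r - q ∈ (Y'.map d)ᗮ := Submodule.sub_starProjection_mem_orthogonal _
      have h4 : r - q ∈ X' ⊓ LinearMap.ker d ⊓ (Y'.map d)ᗮ := by
        refine ⟨⟨Submodule.sub_mem _ (hR _ hwd).1 hqX.1, ?_⟩, h3⟩
        exact (map_sub d r q).trans (by rw [hdR _ hwd, hqX.2, sub_zero])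
      have h5 : ⟪r - q, r⟫_ℝ = 0 := h1 ⟨_, h4⟩
      have h6 : ⟪r - q, q⟫_ℝ = 0 := (Submodule.mem_orthogonal' _ _).1 h3 q hqm
      have h7 : r - q = 0 := by
        rw [← inner_self_eq_zero (𝕜 := ℝ), inner_sub_right, h5, h6, sub_zero]
      rw [sub_eq_zero.1 h7]
      exact hqm
    have h3 : (w : H) ∈ Y.map d := (hbd ⟨w, w.2.1.1⟩ hwd).2 h2
    have h4 : ⟪(w : H), (w : H)⟫_ℝ = 0 := (Submodule.mem_orthogonal' _ _).1 w.2.2 _ h3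
    exact Subtype.ext (inner_self_eq_zero.1 h4)
  exact ⟨LinearEquiv.ofBijective g ⟨hinj, hsurj⟩, fun h => ⟨hX h.2.1.1, rfl⟩⟩

namespace FEComplex

variable {n : ℕ} (A : FEComplex n) (S : A.ScalarProducts)

/-! ### The regularizers on closed forms -/

theorem component_eq_zero_of_notMem {I : Set (ℕ × ℕ)} {ω : A.Total S} (hω : ω ∈ A.supported S I)
    {k m : ℕ} (h : (k, m) ∉ I) : A.component S k m ω = 0 :=
  (A.mem_supported_iff S).1 hω k m h

/-- Below dimension `m₀` there are no components, so in dimension `m₀ - 1` nothing but `T` of the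
lowest component contributes to `d z`. For `m₀ = 0` there is nothing to check, as `T` vanishes on
vertices. -/
theorem TT_lowest_component_eq_zero {k : ℤ} {b k₀ m₀ : ℕ} (hm : m₀ + b = n)
    {z : A.Total S} (hz : z ∈ A.Lam S k n (b + 1))
    (hd : ∀ m, m₀ = m + 1 → A.component S k₀ m (A.d S z) = 0) :
    A.TT S (A.component S k₀ m₀ z) = 0 := by
  cases m₀ with
  | zero => exact A.TT_component_zero S k₀ z
  | succ m =>
    refine A.TT_component_eq_zero S (hd m rfl) fun k' hk' => ?_
    refine A.component_eq_zero_of_notMem S hz ?_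
    rintro ⟨j, hj, -, h2⟩
    dsimp only at h2
    omega

/-- Only the component of highest degree contributes to `d z` in form degree `b + 1`, and only
through `D`. -/
theorem DD_highest_component_eq_zero {m b : ℕ} {z : A.Total S} (hz : z ∈ A.Gam S 0 m (b + 1))
    (hd : A.component S (b + 1) (m + b) (A.d S z) = 0) :
    A.DD S (A.component S b (m + b) z) = 0 := by
  refine A.DD_component_eq_zero S hd (A.component_eq_zero_of_notMem S hz ?_)
  rintro ⟨j, hj, h1, h2⟩
  dsimp only at h1 h2
  omega

theorem d_mem_Lam {k : ℤ} {b : ℕ} {y : A.Total S} (hy : y ∈ A.Lam S (k - 1) n b) :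
    A.d S y ∈ A.Lam S k n (b + 1) := by
  cases b with
  | zero =>
    rw [A.d_of_mem S (fun q hq => hq.2) hy.1, LinearMap.mem_ker.1 hy.2, sub_zero]
    refine Submodule.smul_mem _ _ (A.DD_mem S ?_ hy.1)
    rintro k' m ⟨h1, h2⟩
    exact ⟨0, by omega, by push_cast; omega, h2⟩
  | succ b =>
    refine A.d_mem S ?_ ?_ hy
    · rintro k' m ⟨j, hj, h1, h2⟩
      exact ⟨j, by omega, by push_cast; omega, h2⟩
    · rintro k' m ⟨j, hj, h1, h2⟩
      dsimp only at h1 h2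
      exact ⟨j + 1, by omega, by push_cast; omega, by dsimp only; omega⟩

theorem d_mem_Gam {m b : ℕ} {y : A.Total S} (hy : y ∈ A.Gam S 0 (m + 1) b) :
    A.d S y ∈ A.Gam S 0 m (b + 1) := by
  cases b with
  | zero =>
    rw [A.d_of_mem S (fun q hq => hq.2) hy.1, LinearMap.mem_ker.1 hy.2, zero_sub]
    refine Submodule.smul_mem _ _ (Submodule.neg_mem _ (A.TT_mem S ?_ hy.1))
    rintro k' m' ⟨h1, h2⟩
    dsimp only at h1 h2
    exact ⟨0, by omega, by dsimp only; omega, by dsimp only; omega⟩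
  | succ b =>
    refine A.d_mem S ?_ ?_ hy
    · rintro k' m' ⟨j, hj, h1, h2⟩
      dsimp only at h1 h2
      exact ⟨j + 1, by omega, by dsimp only; omega, by dsimp only; omega⟩
    · rintro k' m' ⟨j, hj, h1, h2⟩
      dsimp only at h1 h2
      exact ⟨j, by omega, by dsimp only; omega, by dsimp only; omega⟩

theorem Lam_mono {k : ℤ} {b : ℕ} : A.Lam S k n b ≤ A.Lam S k n (b + 1) := by
  cases b with
  | zero =>
    refine inf_le_left.trans (A.supported_mono S ?_)
    rintro q ⟨h1, h2⟩
    exact ⟨0, by omega, by push_cast; omega, h2⟩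
  | succ b =>
    refine A.supported_mono S ?_
    rintro q ⟨j, hj, h⟩
    exact ⟨j, by omega, h⟩

theorem Gam_mono {m b : ℕ} : A.Gam S 0 m b ≤ A.Gam S 0 m (b + 1) := by
  cases b with
  | zero =>
    refine inf_le_left.trans (A.supported_mono S ?_)
    rintro q ⟨h1, h2⟩
    exact ⟨0, by omega, h1, h2⟩
  | succ b =>
    refine A.supported_mono S ?_
    rintro q ⟨j, hj, h⟩
    exact ⟨j, by omega, h⟩

theorem preR_apply {E : A.VertOps} {k c k₀ m₀ : ℕ} (hk : k₀ + (c + 1) = k) (hm : m₀ + (c + 1) = n)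
    (z : A.Total S) : A.preR S E k (c + 2) z = z -
      A.d S ((-1 : ℝ) ^ (c + 3) • A.EE S E (A.component S k₀ m₀ z)) := by
  have h1 : k + 1 - (c + 2) = k₀ := by omega
  have h2 : n + 1 - (c + 2) = m₀ := by omega
  rw [map_smul, preR, h1, h2]
  rfl

theorem preS_apply {P : A.HorizOps} {m c : ℕ} (z : A.Total S) :
    A.preS S P m (c + 2) z = z +
      A.d S ((-1 : ℝ) ^ (c + 2 + (n - m)) • A.PP S P (A.component S (c + 1) (m + (c + 1)) z)) := by
  rw [map_smul, preS]
  rfl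

theorem EE_component_mem (E : A.VertOps) (k m : ℕ) (z : A.Total S) :
    A.EE S E (A.component S k m z) ∈ A.supported S {(k, m + 1)} := by
  refine A.EE_mem S E ?_ (A.component_mem S k m z)
  rintro k' m' h
  obtain ⟨rfl, rfl⟩ := Prod.mk.inj h
  rfl

theorem PP_component_mem (P : A.HorizOps) (k m : ℕ) (z : A.Total S) :
    A.PP S P (A.component S (k + 1) m z) ∈ A.supported S {(k, m)} := by
  refine A.PP_mem S P ?_ (A.component_mem S (k + 1) m z)
  rintro k' m' h
  obtain ⟨h1, rfl⟩ := Prod.mk.inj h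
  exact Prod.ext (Nat.succ.inj h1) rfl

theorem DD_mem_singleton {k m : ℕ} {ω : A.Total S} (h : ω ∈ A.supported S {(k, m)}) :
    A.DD S ω ∈ A.supported S {(k + 1, m)} := by
  refine A.DD_mem S ?_ h
  rintro k' m' h
  obtain ⟨rfl, rfl⟩ := Prod.mk.inj h
  rfl

theorem TT_mem_singleton {k m : ℕ} {ω : A.Total S} (h : ω ∈ A.supported S {(k, m + 1)}) :
    A.TT S ω ∈ A.supported S {(k, m)} := by
  refine A.TT_mem S ?_ h
  rintro k' m' h
  obtain ⟨rfl, h1⟩ := Prod.mk.inj h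
  exact Prod.ext rfl (Nat.succ.inj h1)

/-- For closed `z` the lowest component lies in the kernel of `T`, hence in its range because its
dimension is below `n`. There `T E` is the identity, so the correction cancels this component and
leaves a term one step up the diagonal. -/
theorem preR_of_closed (hgeom : A.GeometricDecomposition) (hpatch : A.LocalPatch) {E : A.VertOps}
    (hE : A.IsVertInverse E) {k c k₀ m₀ : ℕ} (hk : k₀ + (c + 1) = k) (hm : m₀ + (c + 1) = n)
    {z : A.Total S} (hz : z ∈ A.Lam S k n (c + 2)) (hd : A.d S z = 0) :
    A.preR S E k (c + 2) z =
      z - A.component S k₀ m₀ z + A.DD S (A.EE S E (A.component S k₀ m₀ z)) := by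
  have h0 : A.TT S (A.component S k₀ m₀ z) = 0 :=
    A.TT_lowest_component_eq_zero S (b := c + 1) hm hz
      fun m _ => by rw [hd, map_zero]
  obtain ⟨η, -, hη⟩ := A.exists_TT_eq S hgeom hpatch (by omega) (A.component_mem S k₀ m₀ z) h0
  have h1 : A.TT S (A.EE S E (A.component S k₀ m₀ z)) = A.component S k₀ m₀ z := by
    rw [← hη, A.TT_EE_TT S hE]
  rw [A.preR_apply S hk hm, map_smul,
    A.d_of_mem S (fun q hq => congrArg Prod.snd hq) (A.EE_component_mem S E k₀ m₀ z), h1, smul_smul,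
    -- The form `E z₀` lives in dimension `m₀ + 1 = n - c`, where `d` carries the sign `(-1)^c`;
    -- with the factor `(-1)^(c + 3)` the total sign is `-1`.
    ← pow_add, Odd.neg_one_pow (by rw [Nat.odd_iff]; dsimp only; omega)]
  module

/-- The counterpart at the other end: the component of highest degree is closed under `D` and has
positive degree `c + 1`, so `D P` fixes it. What replaces it lies one step down the diagonal. -/
theorem preS_of_closed (hexact : A.LocalExactness) {P : A.HorizOps}
    (hP : A.IsHorizInverse P) {m c : ℕ} (hm : m + (c + 1) ≤ n)
    {z : A.Total S} (hz : z ∈ A.Gam S 0 m (c + 2)) (hd : A.d S z = 0) :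
    A.preS S P m (c + 2) z = z - A.component S (c + 1) (m + (c + 1)) z +
      A.TT S (A.PP S P (A.component S (c + 1) (m + (c + 1)) z)) := by
  have h0 : A.DD S (A.component S (c + 1) (m + (c + 1)) z) = 0 :=
    A.DD_highest_component_eq_zero S hz (by rw [hd, map_zero])
  obtain ⟨η, -, hη⟩ := A.exists_DD_eq S hexact (A.component_mem S (c + 1) (m + (c + 1)) z) h0
  have h1 : A.DD S (A.PP S P (A.component S (c + 1) (m + (c + 1)) z)) =
      A.component S (c + 1) (m + (c + 1)) z := by
    rw [← hη, A.DD_PP_DD S hP]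
  rw [A.preS_apply S, map_smul,
    A.d_of_mem S (fun q hq => congrArg Prod.snd hq) (A.PP_component_mem S P c _ z), h1, smul_smul,
    -- The exponents `c + 2 + (n - m)` and `n - (m + c + 1)` add up to `2 (n - m) + 1`.
    ← pow_add, Odd.neg_one_pow (by rw [Nat.odd_iff]; dsimp only; omega)]
  module

theorem exists_distHarm_equiv (hgeom : A.GeometricDecomposition) (hpatch : A.LocalPatch)
    {E : A.VertOps} (hE : A.IsVertInverse E) {k b : ℕ} (hb : 2 ≤ b) (hbk : b ≤ k + 1) (hk : k ≤ n) :
    ∃ e : A.distHarm S k n (b - 1) ≃ₗ[ℝ] A.distHarm S k n b,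
      ∀ h : A.distHarm S k n (b - 1), ∃ hh : (h : A.Total S) ∈ A.Lam S k n b,
        (e h : A.Total S) = A.QR S E hb hbk hk ⟨h, hh⟩ := by
  obtain ⟨c, rfl⟩ : ∃ c, b = c + 2 := ⟨b - 2, by omega⟩
  obtain ⟨k₀, hk₀⟩ : ∃ k₀, k₀ + (c + 1) = k := ⟨k - (c + 1), by omega⟩
  obtain ⟨m₀, hm₀⟩ : ∃ m₀, m₀ + (c + 1) = n := ⟨n - (c + 1), by omega⟩
  refine exists_equiv_projection_adjoint (A.d S) (X := A.Lam S k n (c + 2))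
    (X' := A.Lam S k n (c + 1)) (Y := A.Lam S (k - 1) n (c + 1)) (Y' := A.Lam S (k - 1) n c)
    (A.Lam_mono S) (fun y => A.d_mem_Lam S) (fun y => A.d_mem_Lam S) (A.Lam_mono S) (A.d_d S)
    (A.R S E hb hbk hk) ?_ ?_ ?_
  · rintro ⟨z, hz⟩ hd
    constructor
    · change A.preR S E k (c + 2) z ∈ _
      rw [A.preR_of_closed S hgeom hpatch hE hk₀ hm₀ hz hd]
      refine Submodule.add_mem _ (A.sub_component_mem S ?_ hz)
        (A.supported_mono S ?_ (A.DD_mem_singleton S (A.EE_component_mem S E k₀ m₀ z)))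
      · rintro ⟨k', m'⟩ ⟨j, hj, h1, h2⟩ hne
        refine ⟨j, ?_, h1, h2⟩
        dsimp only at h1 h2
        by_contra hc
        exact hne (Prod.ext (by dsimp only; omega) (by dsimp only; omega))
      · rintro _ rfl
        exact ⟨c, by omega, by push_cast; omega, by dsimp only; omega⟩
    · refine ⟨(-1 : ℝ) ^ (c + 3) • A.EE S E (A.component S k₀ m₀ z), ?_, ?_⟩
      · refine Submodule.smul_mem _ _ (A.supported_mono S ?_ (A.EE_component_mem S E k₀ m₀ z))
        rintro _ rfl
        exact ⟨c, by omega, by push_cast; omega, by dsimp only; omega⟩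
      · change _ = z - A.preR S E k (c + 2) z
        rw [A.preR_apply S hk₀ hm₀, sub_sub_cancel]
  · rintro ⟨z, hz⟩ hz'
    apply Subtype.ext
    change A.preR S E k (c + 2) z = z
    have h0 : A.component S k₀ m₀ z = 0 := by
      refine A.component_eq_zero_of_notMem S hz' ?_
      rintro ⟨j, hj, -, h2⟩
      dsimp only at h2
      omega
    rw [A.preR_apply S hk₀ hm₀, h0]
    simp
  -- A potential of a form on the shorter diagonal can itself be shortened: its lowest component is
  -- killed by `T`, because `d y` has no component beneath it.
  · intro y hy hdy
    have h0 : A.TT S (A.component S k₀ (m₀ + 1) y) = 0 := by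
      refine A.TT_lowest_component_eq_zero S (b := c) (by omega) hy fun m hm => ?_
      refine A.component_eq_zero_of_notMem S hdy ?_
      rintro ⟨j, hj, -, h2⟩
      dsimp only at h2
      omega
    cases c with
    -- The potential has a single component, in dimension `n`. Vanishing of `T` is precisely
    -- membership in the space with index `b = 0`, so no correction is needed.
    | zero =>
      have hy1 : y ∈ A.supported S {(k₀, m₀ + 1)} := by
        refine A.supported_mono S ?_ hy
        rintro ⟨k', m'⟩ ⟨j, hj, h1, h2⟩
        dsimp only at h1 h2
        have hj : j < 1 := hj
        exact Prod.ext (by dsimp only; omega) (by dsimp only; omega)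
      refine ⟨y, ⟨A.supported_mono S ?_ hy1, ?_⟩, rfl⟩
      · rintro _ rfl
        exact ⟨by dsimp only; omega, by dsimp only; omega⟩
      · rwa [A.component_of_mem S hy1] at h0
    | succ c =>
      obtain ⟨η, hη, e⟩ := A.exists_TT_eq S hgeom hpatch (by omega)
        (A.component_mem S k₀ (m₀ + 1) y) h0
      -- The sign cancels the one in `d η`, so that `D η - T η` is added; this removes the lowest
      -- component `T η` of `y` and leaves `d y` unchanged.
      refine ⟨y + (-1 : ℝ) ^ (n - (m₀ + 1 + 1)) • A.d S η, ?_, ?_⟩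
      · rw [A.d_of_mem S (fun q hq => congrArg Prod.snd hq) hη, e, smul_smul, ← mul_pow]
        have h1 : y + ((-1 : ℝ) * -1) ^ (n - (m₀ + 1 + 1)) •
            (A.DD S η - A.component S k₀ (m₀ + 1) y) =
            y - A.component S k₀ (m₀ + 1) y + A.DD S η := by
          rw [neg_one_mul, neg_neg, one_pow]; module
        rw [h1]
        refine Submodule.add_mem _ (A.sub_component_mem S ?_ hy)
          (A.supported_mono S ?_ (A.DD_mem_singleton S hη))
        · rintro ⟨k', m'⟩ ⟨j, hj, h1, h2⟩ hne
          refine ⟨j, ?_, h1, h2⟩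
          dsimp only at h1 h2
          by_contra hc
          exact hne (Prod.ext (by dsimp only; omega) (by dsimp only; omega))
        · rintro _ rfl
          exact ⟨c, by omega, by push_cast; omega, by dsimp only; omega⟩
      · rw [map_add, map_smul, d_d, smul_zero, add_zero]

theorem exists_distVharm_equiv (hexact : A.LocalExactness) {P : A.HorizOps}
    (hP : A.IsHorizInverse P) {m b : ℕ} (hb : 2 ≤ b) (hbm : m + b ≤ n + 1) :
    ∃ e : A.distVharm S 0 m (b - 1) ≃ₗ[ℝ] A.distVharm S 0 m b,
      ∀ h : A.distVharm S 0 m (b - 1), ∃ hh : (h : A.Total S) ∈ A.Gam S 0 m b,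
        (e h : A.Total S) = A.QS S P m hb ⟨h, hh⟩ := by
  obtain ⟨c, rfl⟩ : ∃ c, b = c + 2 := ⟨b - 2, by omega⟩
  refine exists_equiv_projection_adjoint (A.d S) (X := A.Gam S 0 m (c + 2))
    (X' := A.Gam S 0 m (c + 1)) (Y := A.Gam S 0 (m + 1) (c + 1)) (Y' := A.Gam S 0 (m + 1) c)
    (A.Gam_mono S) (fun y => A.d_mem_Gam S) (fun y => A.d_mem_Gam S) (A.Gam_mono S) (A.d_d S)
    (A.regS S P m hb) ?_ ?_ ?_
  · rintro ⟨z, hz⟩ hd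
    constructor
    · change A.preS S P m (c + 2) z ∈ _
      rw [A.preS_of_closed S hexact hP (by omega) hz hd]
      refine Submodule.add_mem _ (A.sub_component_mem S ?_ hz)
        (A.supported_mono S ?_ (A.TT_mem_singleton S (m := m + c)
          (A.PP_component_mem S P c (m + (c + 1)) z)))
      · rintro ⟨k', m'⟩ ⟨j, hj, h1, h2⟩ hne
        refine ⟨j, ?_, h1, h2⟩
        dsimp only at h1 h2
        by_contra hc
        exact hne (Prod.ext (by dsimp only; omega) (by dsimp only; omega))
      · rintro _ rfl
        exact ⟨c, by omega, by dsimp only; omega, rfl⟩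
    · refine ⟨-((-1 : ℝ) ^ (c + 2 + (n - m)) •
        A.PP S P (A.component S (c + 1) (m + (c + 1)) z)), ?_, ?_⟩
      · refine Submodule.neg_mem _ (Submodule.smul_mem _ _
          (A.supported_mono S ?_ (A.PP_component_mem S P c (m + (c + 1)) z)))
        rintro _ rfl
        exact ⟨c, by omega, by dsimp only; omega, by dsimp only; omega⟩
      · change _ = z - A.preS S P m (c + 2) z
        rw [A.preS_apply S, map_neg, sub_add_cancel_left]
  · rintro ⟨z, hz⟩ hz'
    apply Subtype.ext
    change A.preS S P m (c + 2) z = z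
    have h0 : A.component S (c + 1) (m + (c + 1)) z = 0 := by
      refine A.component_eq_zero_of_notMem S hz' ?_
      rintro ⟨j, hj, h1, h2⟩
      dsimp only at h1 h2
      omega
    rw [A.preS_apply S, h0]
    simp
  -- The same shortening from the other end: `d y` has no component of degree `c + 1`, so `D` kills
  -- the component of `y` of degree `c`.
  · intro y hy hdy
    have h0 : A.DD S (A.component S c (m + 1 + c) y) = 0 := by
      refine A.DD_highest_component_eq_zero S hy (A.component_eq_zero_of_notMem S hdy ?_)
      rintro ⟨j, hj, h1, h2⟩
      dsimp only at h1 h2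
      omega
    cases c with
    | zero =>
      have hy1 : y ∈ A.supported S {(0, m + 1)} := by
        refine A.supported_mono S ?_ hy
        rintro ⟨k', m'⟩ ⟨j, hj, h1, h2⟩
        dsimp only at h1 h2
        have hj : j < 1 := hj
        exact Prod.ext (by dsimp only; omega) (by dsimp only; omega)
      refine ⟨y, ⟨A.supported_mono S ?_ hy1, ?_⟩, rfl⟩
      · rintro _ rfl
        exact ⟨rfl, rfl⟩
      · rwa [add_zero, A.component_of_mem S hy1] at h0
    | succ c =>
      obtain ⟨η, hη, e⟩ := A.exists_DD_eq S hexact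
        (A.component_mem S (c + 1) (m + 1 + (c + 1)) y) h0
      refine ⟨y - (-1 : ℝ) ^ (n - (m + 1 + (c + 1))) • A.d S η, ?_, ?_⟩
      · rw [A.d_of_mem S (fun q hq => congrArg Prod.snd hq) hη, e, smul_smul, ← mul_pow]
        have h1 : y - ((-1 : ℝ) * -1) ^ (n - (m + 1 + (c + 1))) •
            (A.component S (c + 1) (m + 1 + (c + 1)) y - A.TT S η) =
            y - A.component S (c + 1) (m + 1 + (c + 1)) y + A.TT S η := by
          rw [neg_one_mul, neg_neg, one_pow]; module
        rw [h1]
        refine Submodule.add_mem _ (A.sub_component_mem S ?_ hy)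
          (A.supported_mono S ?_ (A.TT_mem_singleton S (m := m + 1 + c) hη))
        · rintro ⟨k', m'⟩ ⟨j, hj, h1, h2⟩ hne
          refine ⟨j, ?_, h1, h2⟩
          dsimp only at h1 h2
          by_contra hc
          exact hne (Prod.ext (by dsimp only; omega) (by dsimp only; omega))
        · rintro _ rfl
          exact ⟨c, by omega, by dsimp only; omega, rfl⟩
      · rw [map_sub, map_smul, d_d, smul_zero, sub_zero]

/-! ### The ends and the middle of the chain of isomorphisms -/

/-- The two parts of `d ω` lie in different simplex dimensions, `m` and `m - 1`, and cannot cancel.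
-/
theorem d_eq_zero_iff {I : Set (ℕ × ℕ)} {m : ℕ} (hI : ∀ q ∈ I, q.2 = m) {ω : A.Total S}
    (h : ω ∈ A.supported S I) : A.d S ω = 0 ↔ A.DD S ω = 0 ∧ A.TT S ω = 0 := by
  rw [A.d_of_mem S hI h]
  constructor
  · intro h0
    have h1 := sub_eq_zero.1 (smul_pow_eq_zero h0)
    have h2 : A.DD S ω ∈ A.supported S {q | q.2 = m} := A.DD_mem S (fun k m' hq => hI _ hq) h
    have h3 : A.TT S ω ∈ A.supported S {q | q.2 + 1 = m} := A.TT_mem S (fun k m' hq => hI _ hq) h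
    have h4 : A.DD S ω = 0 := by
      ext p : 1
      by_cases hp : (p.2 : ℕ) = m
      · rw [h1]
        exact h3 p fun h' => by
          have h5 : (p.2 : ℕ) + 1 = m := h'
          omega
      · exact h2 p hp
    exact ⟨h4, h1 ▸ h4⟩
  · rintro ⟨h1, h2⟩
    rw [h1, h2, sub_zero, smul_zero]

theorem map_eq_map_of_smul {V : Type*} [AddCommGroup V] [Module ℝ V] (f g : V →ₗ[ℝ] V)
    (X : Submodule ℝ V) {c : ℝ} (hc : c ≠ 0) (h : ∀ x ∈ X, f x = c • g x) : X.map f = X.map g := by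
  ext v
  constructor
  · rintro ⟨x, hx, rfl⟩
    exact ⟨c • x, X.smul_mem c hx, by rw [map_smul, h x hx]⟩
  · rintro ⟨x, hx, rfl⟩
    exact ⟨c⁻¹ • x, X.smul_mem _ hx, by rw [map_smul, h x hx, smul_smul, inv_mul_cancel₀ hc,
      one_smul]⟩

theorem vharm_eq_distVharm (m : ℕ) : A.vharm S 0 m = A.distVharm S 0 m 1 := by
  have h1 : A.Gam S 0 m 0 ⊓ LinearMap.ker (A.TT S) = A.Gam S 0 m 1 ⊓ LinearMap.ker (A.d S) := by
    have hset : A.Gam S 0 m 1 = A.supported S {q | q.1 = 0 ∧ q.2 = m} := by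
      refine congrArg (A.supported S) (Set.ext fun q => ⟨?_, fun h => ⟨0, by omega, h⟩⟩)
      rintro ⟨j, hj, h⟩
      obtain rfl : j = 0 := Nat.lt_one_iff.1 hj
      exact h
    rw [hset]
    ext ω
    constructor
    · rintro ⟨⟨h1, h2⟩, h3⟩
      exact ⟨h1, (A.d_eq_zero_iff S (fun q hq => hq.2) h1).2 ⟨h2, h3⟩⟩
    · rintro ⟨h1, h2⟩
      obtain ⟨h3, h4⟩ := (A.d_eq_zero_iff S (fun q hq => hq.2) h1).1 h2
      exact ⟨⟨h1, h3⟩, h4⟩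
  have h2 : (A.Gam S 0 (m + 1) 0).map (A.d S) = (A.Gam S 0 (m + 1) 0).map (A.TT S) := by
    refine map_eq_map_of_smul _ _ _ (c := -(-1) ^ (n - (m + 1)))
      (neg_ne_zero.2 (pow_ne_zero _ (by norm_num))) fun ω hω => ?_
    rw [A.d_of_mem S (fun q hq => hq.2) hω.1, LinearMap.mem_ker.1 hω.2, zero_sub, smul_neg,
      neg_smul]
  rw [vharm, distVharm, h1, h2]

theorem distHarm_eq_harm (k : ℤ) : A.distHarm S k n 1 = A.harm S k n := by
  have h1 : A.Lam S k n 0 ⊓ LinearMap.ker (A.DD S) = A.Lam S k n 1 ⊓ LinearMap.ker (A.d S) := by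
    have hset : A.Lam S k n 1 = A.supported S {q | (q.1 : ℤ) = k ∧ q.2 = n} := by
      refine congrArg (A.supported S) (Set.ext fun q => ⟨?_, fun h => ⟨0, by omega, ?_⟩⟩)
      · rintro ⟨j, hj, h⟩
        obtain rfl : j = 0 := Nat.lt_one_iff.1 hj
        simpa using h
      · simpa using h
    rw [hset]
    ext ω
    constructor
    · rintro ⟨⟨h1, h2⟩, h3⟩
      exact ⟨h1, (A.d_eq_zero_iff S (fun q hq => hq.2) h1).2 ⟨h3, h2⟩⟩
    · rintro ⟨h1, h2⟩
      obtain ⟨h3, h4⟩ := (A.d_eq_zero_iff S (fun q hq => hq.2) h1).1 h2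
      exact ⟨⟨h1, h4⟩, h3⟩
  have h2 : (A.Lam S (k - 1) n 0).map (A.d S) = (A.Lam S (k - 1) n 0).map (A.DD S) := by
    refine map_eq_map_of_smul _ _ _ (c := (-1) ^ (n - n))
      (pow_ne_zero _ (by norm_num)) fun ω hω => ?_
    rw [A.d_of_mem S (fun q hq => hq.2) hω.1, LinearMap.mem_ker.1 hω.2, sub_zero]
  rw [harm, distHarm, h1, h2]

/-- Both index sets are the full diagonal from `(0, n - k)` to `(k, n)`, traversed in opposite
directions. -/
theorem Gam_eq_Lam {k : ℕ} (hk : k ≤ n) : A.Gam S 0 (n - k) (k + 1) = A.Lam S k n (k + 1) := by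
  refine congrArg (A.supported S) (Set.ext fun q => ⟨?_, ?_⟩)
  · rintro ⟨j, hj, h1, h2⟩
    exact ⟨k - j, by omega, by omega, by omega⟩
  · rintro ⟨j, hj, h1, h2⟩
    exact ⟨k - j, by omega, by omega, by omega⟩

theorem distVharm_eq_distHarm {k : ℕ} (hk : k ≤ n) :
    A.distVharm S 0 (n - k) (k + 1) = A.distHarm S k n (k + 1) := by
  have h : A.Gam S 0 (n - k + 1) k = A.Lam S (k - 1) n k := by
    cases k with
    -- Both spaces of potentials vanish: one would live in simplex dimension `n + 1`, the other in
    -- form degree `-1`.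
    | zero =>
      trans ⊥
      · rw [eq_bot_iff]
        refine fun ω hω => A.eq_zero_of_mem_supported S (k := 0) (m := n + 1) (Or.inr (by omega))
          (A.supported_mono S ?_ hω.1)
        rintro ⟨k', m'⟩ ⟨h1, h2⟩
        exact Prod.ext h1 h2
      · refine (eq_bot_iff.2 fun ω hω => ?_).symm
        refine A.eq_zero_of_mem_supported S (k := 0) (m := n + 1) (Or.inr (by omega))
          (A.supported_mono S ?_ hω.1)
        rintro ⟨k', m'⟩ ⟨h1, h2⟩
        dsimp only at h1
        omega
    | succ k =>
      have h1 := A.Gam_eq_Lam S (k := k) (by omega)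
      have h2 : n - (k + 1) + 1 = n - k := by omega
      have h3 : ((k + 1 : ℕ) : ℤ) - 1 = k := by push_cast; omega
      rw [h2, h3, h1]
  rw [distVharm, distHarm, A.Gam_eq_Lam S hk, Nat.add_sub_cancel, h]

end FEComplex
theorem indicator_ne_zero {n : ℕ} {C : Finset (Eucl n)} (hC : C.Nonempty) : indicator C ≠ 0 := by
  obtain ⟨x, hx⟩ := hC
  intro h
  have h1 := congrFun (congrArg Subtype.val h) ⟨x, subset_convexHull ℝ _ (Finset.mem_coe.2 hx)⟩
  exact one_ne_zero (congrArg (fun α : Dir C [⋀^Fin 0]→L[ℝ] ℝ => α fun i => i.elim0) h1)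

namespace FEComplex

variable {n : ℕ} (A : FEComplex n) (S : A.ScalarProducts)

/-! ### Simplicial homology -/

/-- The chain `∑ c_C C`, considered as the form `∑ c_C 1_C`. -/
def chainBroken (hA : A.LocalExactness) (m : ℕ) :
    A.Chain A.T.faces A.U.faces m →ₗ[ℝ] A.Broken 0 m where
  toFun c C := c C • A.indicatorForm hA C
  map_add' _ _ := funext fun _ => add_smul _ _ _
  map_smul' _ _ := funext fun _ => mul_smul _ _ _

theorem chainBroken_injective (hA : A.LocalExactness) (m : ℕ) :
    Function.Injective (A.chainBroken hA m) := by
  intro c c' h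
  funext C
  have hne : A.indicatorForm hA C ≠ 0 := fun h0 => indicator_ne_zero
    (Finset.card_pos.1 (by rw [C.1.2.2]; omega)) (congrArg Subtype.val h0)
  exact smul_left_injective ℝ hne (congrFun h C)

theorem D_chainBroken (hA : A.LocalExactness) {m : ℕ} (c : A.Chain A.T.faces A.U.faces m) :
    A.D 0 m (A.chainBroken hA m c) = 0 := by
  funext C
  have h : A.dd 0 C.1.2.1 (A.indicatorForm hA C) = 0 :=
    Subtype.ext ((hA C.1.1 C.2.1 C.2.2).1.ge (Submodule.mem_span_singleton_self _)).2
  exact ((A.dd 0 C.1.2.1).map_smul (c C) _).trans (by rw [h, smul_zero]; rfl)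

theorem exists_chainBroken_eq (hA : A.LocalExactness) {m : ℕ} {x : A.Broken 0 m}
    (hx : A.D 0 m x = 0) : ∃ c, A.chainBroken hA m c = x := by
  have h : ∀ C : A.Cell m, ∃ r : ℝ, r • indicator C.1.1 = (x C : SmoothForm 0 C.1.1) := fun C =>
    Submodule.mem_span_singleton.1 ((hA C.1.1 C.2.1 C.2.2).1.le
      ⟨(x C).2, congrArg Subtype.val (congrFun hx C)⟩)
  choose c hc using h
  exact ⟨c, funext fun C => Subtype.ext (hc C)⟩

/-- Indicators restrict to indicators, so `T` acts on the coefficients through the incidence numbers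
alone. -/
theorem Tv_chainBroken (hA : A.LocalExactness) {m : ℕ} (c : A.Chain A.T.faces A.U.faces (m + 1)) :
    A.Tv 0 m (A.chainBroken hA (m + 1) c) =
      A.chainBroken hA m (A.bdry A.T.faces A.U.faces m c) := by
  classical
  funext F
  apply Subtype.ext
  rw [coe_Tv]
  change _ = (∑ C, A.incidence F.1 C.1 * c C) • indicator F.1.1
  rw [Finset.sum_smul]
  refine Finset.sum_congr rfl fun C _ => ?_
  split_ifs with h
  · change A.incidence F.1 C.1 • trace 0 h (c C • indicator C.1.1) = _
    rw [map_smul, trace_indicator, smul_smul]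
  · rw [A.incidence_of_not_subset h, zero_mul, zero_smul]

theorem chainForm_eq (hA : A.LocalExactness) {m : ℕ} (hm : m ≤ n)
    (c : A.Chain A.T.faces A.U.faces m) :
    A.chainForm S hA hm c = A.single S (Nat.zero_le n) hm (A.chainBroken hA m c) := rfl

theorem chainForm_injective (hA : A.LocalExactness) {m : ℕ} (hm : m ≤ n) :
    Function.Injective (A.chainForm S hA hm) :=
  (A.single_injective S (Nat.zero_le n) hm).comp (A.chainBroken_injective hA m)

theorem DD_single_eq_zero {k m : ℕ} (hk : k ≤ n) (hm : m ≤ n) {x : A.Broken k m}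
    (hx : A.D k m x = 0) : A.DD S (A.single S hk hm x) = 0 := by
  rcases hk.lt_or_eq with h | h
  · rw [A.DD_single S h hm, hx, map_zero]
  · exact A.eq_zero_of_mem_supported S (k := k + 1) (m := m) (Or.inl (by omega))
      (A.DD_mem_singleton S (A.single_mem S hk hm x))

theorem chainForm_mem_Gam (hA : A.LocalExactness) {m : ℕ} (hm : m ≤ n)
    (c : A.Chain A.T.faces A.U.faces m) : A.chainForm S hA hm c ∈ A.Gam S 0 m 0 := by
  refine ⟨A.supported_mono S ?_ (A.single_mem S (Nat.zero_le n) hm (A.chainBroken hA m c)),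
    A.DD_single_eq_zero S (Nat.zero_le n) hm (A.D_chainBroken hA c)⟩
  rintro _ rfl
  exact ⟨rfl, rfl⟩

theorem mem_supported_of_mem_Gam {k m : ℕ} {ω : A.Total S} (hω : ω ∈ A.Gam S k m 0) :
    ω ∈ A.supported S {(k, m)} :=
  A.supported_mono S (fun _ hq => Prod.ext hq.1 hq.2) hω.1

theorem exists_chainForm_eq (hA : A.LocalExactness) {m : ℕ} (hm : m ≤ n) {ω : A.Total S}
    (hω : ω ∈ A.Gam S 0 m 0) : ∃ c, A.chainForm S hA hm c = ω := by
  obtain ⟨x, rfl⟩ := A.exists_eq_single S (Nat.zero_le n) hm (A.mem_supported_of_mem_Gam S hω)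
  obtain ⟨c, rfl⟩ := A.exists_chainBroken_eq hA (A.D_eq_zero_of_DD_single S _ hm hω.2)
  exact ⟨c, rfl⟩

theorem TT_chainForm (hA : A.LocalExactness) {m : ℕ} (hm : m + 1 ≤ n)
    (c : A.Chain A.T.faces A.U.faces (m + 1)) : A.TT S (A.chainForm S hA hm c) =
      A.chainForm S hA (Nat.le_of_succ_le hm) (A.bdry A.T.faces A.U.faces m c) := by
  rw [chainForm_eq, A.TT_single S (Nat.zero_le n) hm, Tv_chainBroken, chainForm_eq]

theorem chainForm_zero (hA : A.LocalExactness) {m : ℕ} (hm : m ≤ n) :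
    A.chainForm S hA hm 0 = 0 := by
  rw [chainForm_eq, map_zero, map_zero]

theorem TT_chainForm_eq_zero_iff (hA : A.LocalExactness) {m : ℕ} (hm : m ≤ n)
    (c : A.Chain A.T.faces A.U.faces m) :
    A.TT S (A.chainForm S hA hm c) = 0 ↔ c ∈ A.cycles A.T.faces A.U.faces m := by
  cases m with
  | zero =>
    refine ⟨fun _ => trivial, fun _ => ?_⟩
    rw [chainForm_eq, ← A.component_of_mem S (A.single_mem S (Nat.zero_le n) hm _),
      TT_component_zero]
  | succ m =>
    rw [TT_chainForm, ← A.chainForm_zero S hA (Nat.le_of_succ_le hm)]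
    exact (A.chainForm_injective S hA _).eq_iff

theorem chainForm_mem_map_TT_iff (hA : A.LocalExactness) {m : ℕ} (hm : m ≤ n)
    (c : A.Chain A.T.faces A.U.faces m) :
    A.chainForm S hA hm c ∈ (A.Gam S 0 (m + 1) 0).map (A.TT S) ↔
      c ∈ LinearMap.range (A.bdry A.T.faces A.U.faces m) := by
  rcases hm.lt_or_eq with h | h
  · constructor
    · rintro ⟨ω, hω, e⟩
      obtain ⟨c', rfl⟩ := A.exists_chainForm_eq S hA h hω
      rw [TT_chainForm] at e
      exact ⟨c', A.chainForm_injective S hA hm e⟩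
    · rintro ⟨c', rfl⟩
      exact ⟨_, A.chainForm_mem_Gam S hA h c', A.TT_chainForm S hA h c'⟩
  · constructor
    · rintro ⟨ω, hω, e⟩
      -- In the top dimension both sides are trivial: the total space has no component in dimension
      -- `n + 1`, and `𝒯` has no simplices of that dimension.
      rw [A.eq_zero_of_mem_supported S (Or.inr (by omega)) (A.mem_supported_of_mem_Gam S hω),
        map_zero, ← A.chainForm_zero S hA hm] at e
      rw [← A.chainForm_injective S hA hm e]
      exact zero_mem _
    · rintro ⟨c', rfl⟩
      have h0 : c' = 0 := by
        funext C
        have h1 := A.card_le C.1.2.1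
        rw [C.1.2.2] at h1
        omega
      rw [h0, map_zero, chainForm_zero]
      exact zero_mem _

theorem map_TT_Gam_le (m : ℕ) :
    (A.Gam S 0 (m + 1) 0).map (A.TT S) ≤ A.Gam S 0 m 0 ⊓ LinearMap.ker (A.TT S) := by
  rintro _ ⟨ω, hω, rfl⟩
  refine ⟨⟨?_, ?_⟩, A.TT_TT S ω⟩
  · exact A.supported_mono S (by rintro _ rfl; exact ⟨rfl, rfl⟩)
      (A.TT_mem_singleton S (A.mem_supported_of_mem_Gam S hω))
  · exact (A.DD_TT S ω).trans ((congrArg _ hω.2).trans (map_zero _))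

/-- Project the form of a cycle onto the orthogonal complement of the boundaries. This is onto,
because a harmonic form comes from a cycle and is fixed by the projection; the kernel consists of
the cycles whose forms are boundaries. -/
theorem exists_homology_equiv (hA : A.LocalExactness) {m : ℕ} (hm : m ≤ n) :
    ∃ Φ : A.Homology A.T.faces A.U.faces m ≃ₗ[ℝ] A.vharm S 0 m,
      ∀ ω : A.vharm S 0 m, ∃ c : A.cycles A.T.faces A.U.faces m,
        A.chainForm S hA hm c = ω ∧ Φ (Submodule.Quotient.mk c) = ω := by
  set B := (A.Gam S 0 (m + 1) 0).map (A.TT S) with hB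
  let J : A.cycles A.T.faces A.U.faces m →ₗ[ℝ] A.Total S :=
    A.single S (Nat.zero_le n) hm ∘ₗ A.chainBroken hA m ∘ₗ
      (A.cycles A.T.faces A.U.faces m).subtype
  have hJ : ∀ c, J c = A.chainForm S hA hm c := fun c => rfl
  have hJZ : ∀ c, J c ∈ A.Gam S 0 m 0 ⊓ LinearMap.ker (A.TT S) := fun c =>
    ⟨A.chainForm_mem_Gam S hA hm c, (A.TT_chainForm_eq_zero_iff S hA hm c).2 c.2⟩
  let p : A.cycles A.T.faces A.U.faces m →ₗ[ℝ] A.vharm S 0 m :=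
    LinearMap.codRestrict _ (Bᗮ.starProjection.toLinearMap ∘ₗ J) fun c => by
      refine ⟨?_, Submodule.starProjection_apply_mem _ _⟩
      have h1 : Bᗮ.starProjection (J c) = J c - B.starProjection (J c) := by
        rw [Submodule.starProjection_orthogonal_val]
      change Bᗮ.starProjection (J c) ∈ _
      rw [h1]
      exact Submodule.sub_mem _ (hJZ c)
        (A.map_TT_Gam_le S m (Submodule.starProjection_apply_mem _ _))
  have hp : ∀ ω : A.vharm S 0 m, ∀ c, J c = ω → p c = ω := by
    intro ω c h
    apply Subtype.ext
    change Bᗮ.starProjection (J c) = ω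
    rw [h]
    exact Submodule.starProjection_eq_self_iff.2 ω.2.2
  have hex : ∀ ω : A.vharm S 0 m, ∃ c, J c = ω := by
    intro ω
    obtain ⟨c, hc⟩ := A.exists_chainForm_eq S hA hm ω.2.1.1
    exact ⟨⟨c, (A.TT_chainForm_eq_zero_iff S hA hm c).1 (hc ▸ ω.2.1.2)⟩, hc⟩
  have hsurj : Function.Surjective p := fun ω => (hex ω).imp fun c hc => hp ω c hc
  have hker : (LinearMap.range (A.bdry A.T.faces A.U.faces m)).submoduleOf
      (A.cycles A.T.faces A.U.faces m) = LinearMap.ker p := by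
    ext c
    have h1 : p c = 0 ↔ J c ∈ B := by
      rw [← Subtype.coe_inj]
      change Bᗮ.starProjection (J c) = 0 ↔ _
      rw [Submodule.starProjection_apply_eq_zero_iff, Submodule.orthogonal_orthogonal]
    rw [LinearMap.mem_ker, h1, hJ, hB, A.chainForm_mem_map_TT_iff S hA hm]
    rfl
  refine ⟨(Submodule.quotEquivOfEq _ _ hker).trans (p.quotKerEquivOfSurjective hsurj),
    fun ω => ?_⟩
  obtain ⟨c, hc⟩ := hex ω
  exact ⟨c, hc, hp ω c hc⟩

end FEComplex
end FEDist

theorem theorem5p11 {n : ℕ} (A : FEDist.FEComplex n) (S : A.ScalarProducts)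
    (hexact : A.LocalExactness) (hgeom : A.GeometricDecomposition) (hpatch : A.LocalPatch)
    (E : A.VertOps) (hE : A.IsVertInverse E) (P : A.HorizOps) (hP : A.IsHorizInverse P)
    (k : ℕ) (hk : k ≤ n) :
    (∃ Φ : A.Homology A.T.faces A.U.faces (n - k) ≃ₗ[ℝ] A.vharm S 0 (n - k),
      ∀ ω : A.vharm S 0 (n - k), ∃ c : A.cycles A.T.faces A.U.faces (n - k),
        A.chainForm S hexact (Nat.sub_le n k) c = ω ∧ Φ (Submodule.Quotient.mk c) = ω) ∧
    A.vharm S 0 (n - k) = A.distVharm S 0 (n - k) 1 ∧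
    (∀ (b : ℕ) (hb : 2 ≤ b), b ≤ k + 1 →
      ∃ e : A.distVharm S 0 (n - k) (b - 1) ≃ₗ[ℝ] A.distVharm S 0 (n - k) b,
        ∀ h : A.distVharm S 0 (n - k) (b - 1),
          ∃ hh : (h : A.Total S) ∈ A.Gam S 0 (n - k) b,
            (e h : A.Total S) = A.QS S P (n - k) hb ⟨h, hh⟩) ∧
    A.distVharm S 0 (n - k) (k + 1) = A.distHarm S k n (k + 1) ∧
    (∀ (b : ℕ) (hb : 2 ≤ b) (hbk : b ≤ k + 1),
      ∃ e : A.distHarm S k n (b - 1) ≃ₗ[ℝ] A.distHarm S k n b,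
        ∀ h : A.distHarm S k n (b - 1),
          ∃ hh : (h : A.Total S) ∈ A.Lam S k n b,
            (e h : A.Total S) = A.QR S E hb hbk hk ⟨h, hh⟩) ∧
    A.distHarm S k n 1 = A.harm S k n := by
  exact ⟨A.exists_homology_equiv S hexact (Nat.sub_le n k), A.vharm_eq_distVharm S (n - k),
    fun _ hb hbk => A.exists_distVharm_equiv S hexact hP hb (by omega),
    A.distVharm_eq_distHarm S hk,
    fun _ hb hbk => A.exists_distHarm_equiv S hgeom hpatch hE hb hbk hk,
    A.distHarm_eq_harm S k⟩
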